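/- Let $p$ be an odd prime, $k$ a field of characteristic $p$ and $n\ge 0$. Let $R=k[x_1,\dots,x_n]\otimes\Lambda(\xi_1,\dots,\xi_n)$ be the $\mathbb Z[\frac1p]$-graded commutative $k$-algebra with $|x_i|=\frac{2(p^i-1)}{p^i}$ and $|\xi_i|=|x_i|-1$, and let $\mathcal E_n(p)=\mathsf{Int}(R)$ be the $\mathbb Z$-graded subalgebra formed by the homogeneous parts of $R$ of integer degree, $\mathcal E_n(p)_d=R_d$ for $d\in\mathbb Z$. Then: 1. The ring $\mathcal E_n(p)$ is Gorenstein, i.e. it is left and right Noetherian and has finite injective dimension as a left and as a right module over itself. 2. The elements $y_i=x_i^{p^i}$ ($1\le i\le n$) are central elements of $\mathcal E_n(p)$, homogeneous of degree $2(p^i-1)$, and $y_1,\dots,y_n$ is a homogeneous system of parameters (they are algebraically independent over $k$ and $\mathcal E_n(p)$ is a finitely generated $k[y_1,\dots,y_n]$-module) and a regular sequence on $\mathcal E_n(p)$. 3. The quotient $\mathcal E_n(p)/(y_1,\dots,y_n)$ has dimension $2^np^{n(n-1)/2}$ over $k$ and is a graded Frobenius algebra with dualising element the image of $$\alpha=x_1^{p-1}x_2^{p^2-1}\cdots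 x_n^{p^n-1}\,\xi_1\xi_2\cdots\xi_n\in\mathcal E_n(p),$$ which has degree $D=2\left(\frac{p^{n+1}-1}{p-1}\right)-3n-2$. That is, the part of degree $D$ of the quotient is the line spanned by the nonzero image of $\alpha$, and if $\varphi$ is the linear form that takes the coefficient of $\alpha$ in degree $D$ and vanishes on all other degrees, then the bilinear form $(a,b)\mapsto\varphi(ab)$ is nondegenerate. 4. Each $\mathcal E_n(p)_d$ is finite dimensional, and the Poincaré series $f(q)=\sum_{d\ge0}q^d\dim_k\mathcal E_n(p)_d$ is a rational function of $q$ satisfying $f(1/q)=(-q)^nf(q)$. -/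

import Mathlib

open scoped TensorProduct

universe u

noncomputable section

namespace VerAlg

/-- The ring `ℤ[1/p]`, as a subring of the rationals. -/
abbrev ZInv (p : ℕ) : Subring ℚ := Subring.closure {(p : ℚ)⁻¹}

/-- The element `1/p` of `ℤ[1/p]`. -/
def pInv (p : ℕ) : ZInv p := ⟨(p : ℚ)⁻¹, Subring.subset_closure rfl⟩

section General

variable {k : Type u} [Field k] {A : Type u} [Ring A] [Algebra k A]

/-- `Int(A)` for an algebra `A` graded by a ring `Γ` of degrees (here `Γ = ℤ[1/p]`): the sum of the
homogeneous parts of integer degree. -/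
def intPart {Γ : Type*} [Ring Γ] (𝒜 : Γ → Submodule k A) [SetLike.GradedMonoid 𝒜] :
    Subalgebra k A :=
  (⨆ m : ℤ, 𝒜 (m : Γ)).toSubalgebra
    (Submodule.mem_iSup_of_mem 0 (by
      rw [Int.cast_zero]; exact SetLike.GradedOne.one_mem))
    (fun a b ha hb => by
      have key : (⨆ m : ℤ, 𝒜 (m : Γ)) * (⨆ m : ℤ, 𝒜 (m : Γ)) ≤ ⨆ m : ℤ, 𝒜 (m : Γ) := by
        rw [Submodule.iSup_mul]
        refine iSup_le fun i => ?_
        rw [Submodule.mul_iSup]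
        refine iSup_le fun j => ?_
        refine Submodule.mul_le.2 fun x hx y hy => Submodule.mem_iSup_of_mem (i + j) ?_
        rw [Int.cast_add]
        exact SetLike.GradedMul.mul_mem hx hy
      exact key (Submodule.mul_mem_mul ha hb))

/-- The homogeneous part `Int(A)_m = A_m` for an integer `m`. -/
def intPiece {Γ : Type*} [Ring Γ] (𝒜 : Γ → Submodule k A) [SetLike.GradedMonoid 𝒜] (m : ℤ) :
    Submodule k (intPart 𝒜) :=
  (𝒜 (m : Γ)).comap (intPart 𝒜).val.toLinearMap

/-- A (not necessarily commutative) ring is Gorenstein if it is Noetherian on both sides and has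
finite injective dimension as a left module and as a right module over itself. -/
structure IsGorenstein (A : Type u) [Ring A] : Prop where
  left_noetherian : IsNoetherianRing A
  right_noetherian : IsNoetherianRing Aᵐᵒᵖ
  left_injDim : ∃ m : ℕ, CategoryTheory.HasInjectiveDimensionLE (ModuleCat.of A A) m
  right_injDim : ∃ m : ℕ, CategoryTheory.HasInjectiveDimensionLE (ModuleCat.of Aᵐᵒᵖ A) m

/-- Central elements `y₁, …, yₙ` of a `ℤ`-graded algebra form a homogeneous system of parameters if
they are homogeneous of positive degree, algebraically independent over `k`, and the algebra is a
finitely generated module over `k[y₁, …, yₙ]`. -/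
structure IsHomogeneousParameters (𝒜 : ℤ → Submodule k A) {n : ℕ}
    (y : Fin n → Subalgebra.center k A) : Prop where
  homogeneous : ∀ i, ∃ d : ℤ, 0 < d ∧ (y i : A) ∈ 𝒜 d
  algebraicIndependent : AlgebraicIndependent k y
  finite : Module.Finite (Algebra.adjoin k (Set.range y)) A

/-- The ideal generated by a family of central elements. -/
def centralIdeal {n : ℕ} (y : Fin n → Subalgebra.center k A) : Ideal A :=
  Ideal.span (Set.range fun i => (y i : A))

instance {n : ℕ} (y : Fin n → Subalgebra.center k A) : (centralIdeal y).IsTwoSided where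
  mul_mem_of_left := by
    intro a b ha
    induction ha using Submodule.span_induction with
    | mem x hx =>
      obtain ⟨i, rfl⟩ := hx
      have h : (y i : A) * b = b * (y i : A) :=
        ((Subalgebra.mem_center_iff.1 (y i).2) b).symm
      rw [h]
      exact Ideal.mul_mem_left _ b (Ideal.subset_span ⟨i, rfl⟩)
    | zero => rw [zero_mul]; exact Submodule.zero_mem _
    | add x z _ _ hx hz => rw [add_mul]; exact Submodule.add_mem _ hx hz
    | smul c x _ hx => rw [smul_eq_mul, mul_assoc]; exact Ideal.mul_mem_left _ c hx

/-- The homogeneous part of degree `m` of a quotient: the image of the part of degree `m`. -/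
def quotientPiece (𝒜 : ℤ → Submodule k A) (I : Ideal A) [I.IsTwoSided] (m : ℤ) :
    Submodule k (A ⧸ I) :=
  (𝒜 m).map (Ideal.Quotient.mkₐ k I).toLinearMap

/-- `B` with homogeneous parts `ℬ d` is a graded Frobenius algebra with dualising element `α` in
degree `D`: it is a finite dimensional graded algebra, `ℬ D` is the line spanned by `α ≠ 0`, and if
`φ` is the linear form which picks out the coefficient of `α` in degree `D` and vanishes on all other
degrees, then the bilinear form `(a, b) ↦ φ (a * b)` is nondegenerate on both sides. -/
structure IsGradedFrobenius {B : Type u} [Ring B] [Algebra k B] (ℬ : ℤ → Submodule k B)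
    (D : ℤ) (α : B) : Prop where
  finite : Module.Finite k B
  graded : Nonempty (GradedAlgebra ℬ)
  ne_zero : α ≠ 0
  top_eq : ℬ D = Submodule.span k {α}
  exists_form : ∃ φ : B →ₗ[k] k, φ α = 1 ∧ (∀ d, d ≠ D → ∀ b ∈ ℬ d, φ b = 0) ∧
    (∀ a, (∀ b, φ (a * b) = 0) → a = 0) ∧ (∀ b, (∀ a, φ (a * b) = 0) → b = 0)

/-- The Poincaré series `∑_{d ≥ 0} q^d dim 𝒜_d`. -/
def poincareSeries (𝒜 : ℤ → Submodule k A) : PowerSeries ℚ :=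
  PowerSeries.mk fun d : ℕ => (Module.finrank k (𝒜 (d : ℤ)) : ℚ)

end General

section Algebra

variable (p : ℕ) (k : Type u) [Field k] (n : ℕ)

/-- The algebra `k[x₁, …, xₙ] ⊗ Λ(ξ₁, …, ξₙ)`. The generators `x_{i+1}`, `ξ_{i+1}` are indexed by
`i : Fin n`. The `x`'s have even degree, so no signs occur in the tensor product. -/
def R : Type u := MvPolynomial (Fin n) k ⊗[k] ExteriorAlgebra k (Fin n → k)

instance : Ring (R k n) :=
  inferInstanceAs (Ring (MvPolynomial (Fin n) k ⊗[k] ExteriorAlgebra k (Fin n → k)))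

instance : Algebra k (R k n) :=
  inferInstanceAs (Algebra k (MvPolynomial (Fin n) k ⊗[k] ExteriorAlgebra k (Fin n → k)))

/-- The inclusion of the polynomial part into `R`. -/
def polyIncl : MvPolynomial (Fin n) k →ₐ[k] R k n :=
  (Algebra.TensorProduct.includeLeft :
    MvPolynomial (Fin n) k →ₐ[k] MvPolynomial (Fin n) k ⊗[k] ExteriorAlgebra k (Fin n → k))

/-- The inclusion of the exterior part into `R`. -/
def extIncl : ExteriorAlgebra k (Fin n → k) →ₐ[k] R k n :=
  (Algebra.TensorProduct.includeRight :
    ExteriorAlgebra k (Fin n → k) →ₐ[k]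
      MvPolynomial (Fin n) k ⊗[k] ExteriorAlgebra k (Fin n → k))

theorem polyIncl_central (f : MvPolynomial (Fin n) k) (z : R k n) :
    z * polyIncl k n f = polyIncl k n f * z := by
  induction z using TensorProduct.induction_on with
  | zero => exact (zero_mul (polyIncl k n f)).trans (mul_zero (polyIncl k n f)).symm
  | tmul s t =>
    exact (Algebra.TensorProduct.tmul_mul_tmul s f t 1).trans
      ((by rw [mul_comm s f, mul_one, one_mul] : _ = _).trans
        (Algebra.TensorProduct.tmul_mul_tmul f s 1 t).symm)
  | add s t hs ht =>
    exact (add_mul (R := R k n) s t _).trans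
      ((congrArg₂ (· + ·) hs ht).trans (mul_add (R := R k n) _ s t).symm)

variable {n} in
/-- The polynomial generator `x_{i+1}`. -/
def x (i : Fin n) : R k n := polyIncl k n (MvPolynomial.X i)

variable {n} in
/-- The exterior generator `ξ_{i+1}`. -/
def ξ (i : Fin n) : R k n := extIncl k n (ExteriorAlgebra.ι k (Pi.single i 1))

variable {n} in
/-- The degree `2 (p^j - 1) / p^j` of `x_j`, where `j = i + 1`. -/
def degX (i : Fin n) : ZInv p := 2 * ((p : ZInv p) ^ (i.val + 1) - 1) * pInv p ^ (i.val + 1)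

variable {n} in
/-- The degree of `ξ_j`, one less than that of `x_j`. -/
def degΞ (i : Fin n) : ZInv p := degX p i - 1

variable {n} in
/-- The monomial `x₁^{a₁} ⋯ xₙ^{aₙ} ξ_{l₁} ξ_{l₂} ⋯` for a word `l₁ l₂ ⋯` in the indices. -/
def monom (a : Fin n →₀ ℕ) (l : List (Fin n)) : R k n :=
  polyIncl k n (MvPolynomial.monomial a 1) * (l.map (ξ k)).prod

variable {n} in
/-- The degree of the monomial `monom k a l`. -/
def degMonom (a : Fin n →₀ ℕ) (l : List (Fin n)) : ZInv p :=
  (a.sum fun i m => (m : ZInv p) * degX p i) + (l.map (degΞ p)).sum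

/-- The homogeneous part of degree `d ∈ ℤ[1/p]` of `R`, spanned by the monomials of degree `d`. -/
def piece (d : ZInv p) : Submodule k (R k n) :=
  Submodule.span k {z | ∃ (a : Fin n →₀ ℕ) (l : List (Fin n)), degMonom p a l = d ∧ z = monom k a l}

instance : SetLike.GradedMonoid (piece p k n) where
  one_mem := Submodule.subset_span ⟨0, [], by simp [degMonom], by
    rw [monom, MvPolynomial.monomial_zero', map_one, map_one, List.map_nil, List.prod_nil,
      mul_one]⟩
  mul_mem := by
    intro d e u v hu hv
    have key : piece p k n d * piece p k n e ≤ piece p k n (d + e) := by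
      rw [piece, piece, Submodule.span_mul_span, Submodule.span_le]
      rintro _ ⟨_, ⟨a, l, rfl, rfl⟩, _, ⟨b, m, rfl, rfl⟩, rfl⟩
      refine Submodule.subset_span ⟨a + b, l ++ m, ?_, ?_⟩
      · rw [degMonom, degMonom, degMonom, List.map_append, List.sum_append,
          Finsupp.sum_add_index' (by simp) (by intros; push_cast; ring)]
        ring
      · have hm : polyIncl k n (MvPolynomial.monomial (a + b) 1) =
            polyIncl k n (MvPolynomial.monomial a 1) * polyIncl k n (MvPolynomial.monomial b 1) := by
          rw [← map_mul, MvPolynomial.monomial_mul, one_mul]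
        simp only [monom]
        rw [List.map_append, List.prod_append, hm]
        simp only [mul_assoc]
        rw [← mul_assoc (List.map (ξ k) l).prod, polyIncl_central, mul_assoc]
    exact key (Submodule.mul_mem_mul hu hv)

/-- The algebra `ℰₙ(p) = Int(k[x₁, …, xₙ] ⊗ Λ(ξ₁, …, ξₙ))`. -/
abbrev E : Subalgebra k (R k n) := intPart (piece p k n)

/-- The homogeneous part of `ℰₙ(p)` of degree `m ∈ ℤ`. -/
abbrev EPiece (m : ℤ) : Submodule k (E p k n) := intPiece (piece p k n) m

end Algebra

end VerAlg

end

/-!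
The algebra `ℰₙ(p)` is a free module over the central polynomial ring `P = k[y₁, …, yₙ]`, with basis the
monomials `x^a ξ_I` of integer degree with `a_i < p^i` (`boxBasis`): as `y_i = x_i^(p^i)` has integer degree,
division with remainder of the exponents, `x^b ξ_I = y^m x^a ξ_I`, preserves the set of monomials of
integer degree (`splitEquiv`).

The basis element of top degree is `α`, and complementing the exponents, `a_i ↦ p^i - 1 - a_i`, and the set
`I` is an involution `σ` of the basis. For the `P`-linear form `Φ` that takes the coefficient of `α`, the Gram
matrix of `(a, b) ↦ Φ (a * b)` is monomial: the entry at `(i, j)` is a nonzero constant if `j = σ i` and zero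
otherwise (`boxBasis_gram`). Almost everything follows from this.

* The Gram matrix is invertible over `P`, so `ℰₙ(p) ≅ Hom_P(ℰₙ(p), P)` as left modules. Coinduction from `P` is
  exact and preserves injectives, so the injective dimension of `ℰₙ(p)` is at most that of `P`, which is finite
  by Hilbert's syzygy theorem (`hasProjectiveDimensionLE_mvPolynomial`, `isGorenstein_of_gram`). The transposed
  matrix gives the statement for right modules.
* Freeness over `P` shows that the `y_i` are algebraically independent parameters and a regular sequence.
* The basis induces a `k`-basis of the quotient by the `y_i`, on which the Gram matrix is the reduction of the
  one above (`isGradedFrobenius_quotient`). For the number of basis elements, note that `x^a ξ_I` has integer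
  degree if and only if `∑ (a_i + [i ∈ I]) / p^i` is an integer, `2` being invertible modulo `p`; this congruence
  determines `a_n < p^n` by the other data, which are arbitrary (`card_boxIndex`).
* The Poincaré series is `∑_j q^{deg v_j} / ∏_i (1 - q^{deg y_i})`, for `v_j` the basis over `P`. The involution
  `σ` takes a basis element of degree `d` to one of degree `D - d`, where `D = ∑ deg y_i - n`, and the functional
  equation follows (`eval_inv_X_numer_div_denom`).
-/

noncomputable section

namespace VerAlg

/-! ### Global dimension of polynomial rings -/

section PolynomialGlobalDimension

open CategoryTheory Polynomial

variable {A : Type u} [CommRing A]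

/-- Flat base change takes a projective resolution to a projective resolution, so it does not raise
the projective dimension. -/
theorem hasProjectiveDimensionLE_baseChange {B : Type u} [CommRing B] [Algebra A B]
    [Module.Flat A B] (m : ℕ) (M : Type u) [AddCommGroup M] [Module A M]
    (h : HasProjectiveDimensionLE (ModuleCat.of A M) m) :
    HasProjectiveDimensionLE (ModuleCat.of B (B ⊗[A] M)) m := by
  induction m generalizing M with
  | zero =>
    rw [← projective_iff_hasProjectiveDimensionLE_zero, ← IsProjective.iff_projective] at h ⊢
    infer_instance
  | succ m ih =>
    -- the kernel of a free presentation has smaller projective dimension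
    let π : (M →₀ A) →ₗ[A] M := Finsupp.linearCombination A id
    have hπ : Function.Surjective π := fun x => ⟨Finsupp.single x 1, by simp [π]⟩
    have hS := LinearMap.shortExact_shortComplexKer hπ
    have hK := ih (LinearMap.ker π) ((hS.hasProjectiveDimensionLT_X₃_iff m
      ((IsProjective.iff_projective _).1 inferInstance)).1 h)
    let f : B ⊗[A] LinearMap.ker π →ₗ[B] B ⊗[A] (M →₀ A) :=
      (LinearMap.ker π).subtype.baseChange B
    let g : B ⊗[A] (M →₀ A) →ₗ[B] B ⊗[A] M := π.baseChange B
    have hfg : Function.Exact f g :=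
      Module.Flat.lTensor_exact (R := A) B (N := LinearMap.ker π) (N' := M →₀ A) (N'' := M)
        π.exact_subtype_ker_map
    have hT := ModuleCat.shortComplex_shortExact
      (ModuleCat.shortComplexOfCompEqZero f g hfg.linearMap_comp_eq_zero) hfg
      (Module.Flat.lTensor_preserves_injective_linearMap _ (Submodule.injective_subtype _))
      (LinearMap.lTensor_surjective B hπ)
    exact (hT.hasProjectiveDimensionLT_X₃_iff m
      ((IsProjective.iff_projective _).1 inferInstance)).2 hK

section Characteristic

variable (A) (N : Type u) [AddCommGroup N] [Module A N] [Module A[X] N] [IsScalarTower A A[X] N]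

/-- The endomorphism `X ⊗ 1 - 1 ⊗ X` of `A[X] ⊗ N`, for an `A[X]`-module `N`. -/
def charMap : A[X] ⊗[A] N →ₗ[A[X]] A[X] ⊗[A] N :=
  LinearMap.lsmul A[X] _ (X : A[X]) - (LinearMap.lsmul A[X] N X |>.restrictScalars A).baseChange A[X]

/-- The action map `A[X] ⊗ N → N`. -/
def actionMap : A[X] ⊗[A] N →ₗ[A[X]] N :=
  LinearMap.liftBaseChange A[X] (LinearMap.id : N →ₗ[A] N)

variable {A N}

theorem charMap_tmul (q : A[X]) (x : N) :
    charMap A N (q ⊗ₜ x) = (X * q) ⊗ₜ x - q ⊗ₜ ((X : A[X]) • x) := by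
  simp [charMap, TensorProduct.smul_tmul']

theorem actionMap_tmul (q : A[X]) (x : N) : actionMap A N (q ⊗ₜ[A] x) = q • x := by
  simp [actionMap]

/-- Modulo the image of `X ⊗ 1 - 1 ⊗ X`, every element of `A[X] ⊗ N` comes from `N`. -/
theorem sub_actionMap_mem_range (z : A[X] ⊗[A] N) :
    z - 1 ⊗ₜ actionMap A N z ∈ LinearMap.range (charMap A N) := by
  induction z using TensorProduct.induction_on with
  | zero => simp
  | add a b ha hb =>
    have := add_mem ha hb
    rwa [sub_add_sub_comm, ← TensorProduct.tmul_add, ← map_add] at this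
  | tmul q x =>
    rw [actionMap_tmul]
    induction q using Polynomial.induction_on' with
    | add a b ha hb =>
      have := add_mem ha hb
      rwa [sub_add_sub_comm, ← TensorProduct.tmul_add, ← TensorProduct.add_tmul, ← add_smul] at this
    | monomial i a =>
      induction i generalizing x with
      | zero =>
        have : (monomial 0 a : A[X]) = a • 1 := by
          rw [monomial_zero_left, smul_eq_C_mul, mul_one]
        rw [this, TensorProduct.smul_tmul, smul_assoc, one_smul, sub_self]
        exact zero_mem _
      | succ i ih =>
        have hX : (monomial (i + 1) a : A[X]) = X * monomial i a := by
          rw [X_mul_monomial]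
        have := add_mem (LinearMap.mem_range_self (charMap A N) (monomial i a ⊗ₜ x)) (ih ((X : A[X]) • x))
        rwa [charMap_tmul, sub_add_sub_cancel, smul_smul, mul_comm _ X, ← hX] at this

theorem exact_charMap_actionMap : Function.Exact (charMap A N) (actionMap A N) := by
  intro z
  constructor
  · intro hz
    have := sub_actionMap_mem_range z
    rwa [hz, TensorProduct.tmul_zero, sub_zero] at this
  · rintro ⟨w, rfl⟩
    induction w using TensorProduct.induction_on with
    | zero => simp
    | add a b ha hb => rw [map_add, map_add, ha, hb, add_zero]
    | tmul q x => rw [charMap_tmul, map_sub, actionMap_tmul, actionMap_tmul, smul_smul, mul_comm,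
        sub_self]

/-- The coefficients `z_i` of an element of the kernel satisfy `z_i = X z_{i+1}`; as almost all of them
vanish, all of them do. -/
theorem charMap_injective : Function.Injective (charMap A N) := by
  let e := TensorProduct.equivFinsuppOfBasisLeft (N := N) (Polynomial.basisMonomials A)
  have he (q : A[X]) (x : N) (i : ℕ) : e (q ⊗ₜ x) i = q.coeff i • x := by
    change TensorProduct.equivFinsuppOfBasisLeft _ (q ⊗ₜ x) i = _
    rw [TensorProduct.equivFinsuppOfBasisLeft_apply_tmul_apply]
    rfl
  have hstep (z : A[X] ⊗[A] N) (i : ℕ) :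
      e (charMap A N z) (i + 1) = e z i - (X : A[X]) • e z (i + 1) := by
    induction z using TensorProduct.induction_on with
    | zero => simp
    | add a b ha hb => simp only [map_add, Finsupp.add_apply, ha, hb, smul_add]; abel
    | tmul q x =>
      rw [charMap_tmul, map_sub, Finsupp.sub_apply, he, he, he, he, coeff_X_mul,
        smul_comm (q.coeff (i + 1)) (X : A[X]) x]
  rw [injective_iff_map_eq_zero]
  intro z hz
  have hrec (i : ℕ) : e z i = (X : A[X]) • e z (i + 1) := by
    have := hstep z i
    rw [hz, map_zero, Finsupp.zero_apply] at this
    exact (sub_eq_zero.1 this.symm)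
  have hpow (j i : ℕ) : e z i = (X : A[X]) ^ j • e z (i + j) := by
    induction j with
    | zero => simp
    | succ j ih => rw [ih, hrec (i + j), smul_smul, ← pow_succ, add_assoc]
  apply e.injective
  rw [map_zero]
  ext i
  obtain ⟨b, hb⟩ := (e z).support.exists_nat_subset_range
  have : e z (i + b) = 0 := by
    by_contra h
    have := Finset.mem_range.1 (hb (Finsupp.mem_support_iff.2 h))
    omega
  rw [hpow b i, this, smul_zero, Finsupp.zero_apply]

end Characteristic

/-- Adjoining a variable raises the global dimension by at most one, because of the short exact
sequence `0 → A[X] ⊗ N → A[X] ⊗ N → N → 0` of an `A[X]`-module `N`. -/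
theorem hasProjectiveDimensionLE_polynomial (m : ℕ)
    (h : ∀ M : ModuleCat.{u} A, HasProjectiveDimensionLE M m) (N : ModuleCat.{u} A[X]) :
    HasProjectiveDimensionLE N (m + 1) := by
  let : Module A N := Module.compHom N (C : A →+* A[X])
  have : IsScalarTower A A[X] N := ⟨fun a q x => by
    rw [smul_eq_C_mul, mul_smul]; rfl⟩
  have hT := ModuleCat.shortComplex_shortExact
      (ModuleCat.shortComplexOfCompEqZero (charMap A N) (actionMap A N)
        exact_charMap_actionMap.linearMap_comp_eq_zero) exact_charMap_actionMap
      charMap_injective (fun x => ⟨1 ⊗ₜ x, by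
        change actionMap A N (1 ⊗ₜ x) = x
        rw [actionMap_tmul, one_smul]⟩)
  have hN := hasProjectiveDimensionLE_baseChange (B := A[X]) m N (h (ModuleCat.of A N))
  exact hT.hasProjectiveDimensionLT_X₃ (m + 1) hN
    (hasProjectiveDimensionLT_of_ge _ (m + 1) (m + 1 + 1) (Nat.le_succ _))

theorem hasProjectiveDimensionLE_of_ringEquiv {B : Type u} [CommRing B] (e : A ≃+* B) (m : ℕ)
    (h : ∀ M : ModuleCat.{u} A, HasProjectiveDimensionLE M m) (N : ModuleCat.{u} B) :
    HasProjectiveDimensionLE N m := by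
  let : Module A N := Module.compHom N (e : A →+* B)
  have := h (ModuleCat.of A N)
  let := RingHomInvPair.of_ringEquiv e
  let : RingHomInvPair (RingHomClass.toRingHom e.symm) (RingHomClass.toRingHom e) :=
    RingHomInvPair.of_ringEquiv e.symm
  let e' : ModuleCat.of A N ≃ₛₗ[RingHomClass.toRingHom e] N :=
    { AddEquiv.refl N with map_smul' := fun r x => rfl }
  exact ModuleCat.hasProjectiveDimensionLE_of_semiLinearEquiv e e' m

/-- Hilbert's syzygy theorem, as a bound on the global dimension. -/
theorem hasProjectiveDimensionLE_mvPolynomial (k : Type u) [Field k] (n : ℕ)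
    (N : ModuleCat.{u} (MvPolynomial (Fin n) k)) : HasProjectiveDimensionLE N n := by
  induction n with
  | zero =>
    refine hasProjectiveDimensionLE_of_ringEquiv
      (MvPolynomial.isEmptyRingEquiv k (Fin 0)).symm 0 (fun M => ?_) N
    rw [← projective_iff_hasProjectiveDimensionLE_zero, ← IsProjective.iff_projective]
    exact Module.Projective.of_free
  | succ n ih =>
    exact hasProjectiveDimensionLE_of_ringEquiv
      (MvPolynomial.finSuccEquiv k n).symm.toRingEquiv (n + 1)
      (hasProjectiveDimensionLE_polynomial n ih) N

/-- The injective dimension of a module is at most the global dimension. -/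
theorem hasInjectiveDimensionLE_of_forall_hasProjectiveDimensionLE (m : ℕ)
    (h : ∀ M : ModuleCat.{u} A, HasProjectiveDimensionLE M m) (N : ModuleCat.{u} A) :
    HasInjectiveDimensionLE N m :=
  HasInjectiveDimensionLT.mk fun _ hi Y e =>
    have := h Y
    e.eq_zero_of_hasProjectiveDimensionLT (m + 1) hi

end PolynomialGlobalDimension

/-! ### Frobenius extensions and injective dimension -/

section Coextension

open CategoryTheory

variable {P : Type u} [CommRing P] {S : Type u} [Ring S] [Algebra P S]

/-- If `S` is projective over `P`, then coinduction `Hom_P(S, -)` is exact and preserves injectives,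
so it does not raise the injective dimension. -/
theorem hasInjectiveDimensionLE_coextendScalars [Module.Projective P S] (m : ℕ)
    (M : ModuleCat.{u} P) (h : HasInjectiveDimensionLE M m) :
    HasInjectiveDimensionLE ((ModuleCat.coextendScalars (algebraMap P S)).obj M) m := by
  let F := ModuleCat.coextendScalars.{u, u, u} (algebraMap P S)
  let adj := ModuleCat.restrictCoextendScalarsAdj.{u, u, u} (algebraMap P S)
  induction m generalizing M with
  | zero =>
    rw [HasInjectiveDimensionLE, zero_add, ← injective_iff_hasInjectiveDimensionLT_one] at h ⊢
    exact adj.map_injective M h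
  | succ m ih =>
    obtain ⟨I, hI, f, hf⟩ := EnoughInjectives.presentation M
    have injf : Function.Injective f.hom := (ModuleCat.mono_iff_injective f).1 hf
    let g : I →ₗ[P] (I ⧸ LinearMap.range f.hom) := Submodule.mkQ _
    have hfg : Function.Exact f.hom g := f.hom.exact_map_mkQ_range
    have hS := ModuleCat.shortComplex_shortExact
      (ModuleCat.shortComplexOfCompEqZero f.hom g hfg.linearMap_comp_eq_zero) hfg injf
      (Submodule.mkQ_surjective _)
    have hQ := ih _ ((hS.hasInjectiveDimensionLT_X₃_iff m hI).2 h)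
    have hFI : Injective (F.obj I) := adj.map_injective I hI
    let T : ShortComplex (ModuleCat.{u} S) :=
      { X₁ := F.obj M, X₂ := F.obj I, X₃ := F.obj (ModuleCat.of P (I ⧸ LinearMap.range f.hom))
        f := F.map f, g := F.map (ModuleCat.ofHom g)
        zero := by
          rw [← F.map_comp]
          ext φ
          exact hfg.apply_apply_eq_zero _ }
    have hProj : Module.Projective P ((ModuleCat.restrictScalars (algebraMap P S)).obj
        (ModuleCat.of S S)) := by
      let e : S ≃ₗ[P] (ModuleCat.restrictScalars (algebraMap P S)).obj (ModuleCat.of S S) :=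
        { AddEquiv.refl S with map_smul' := fun r x => Algebra.smul_def r x }
      exact Module.Projective.of_equiv e
    have hT : T.ShortExact := by
      refine ModuleCat.shortComplex_shortExact T ?_ ?_ ?_
      · intro φ
        constructor
        · intro hφ
          have h0 (s) : g (φ s) = 0 := LinearMap.congr_fun hφ s
          let φ' : (ModuleCat.restrictScalars (algebraMap P S)).obj (ModuleCat.of S S) →ₗ[P] I := φ
          let ψ := (LinearEquiv.ofInjective f.hom injf).symm.toLinearMap ∘ₗ
            φ'.codRestrict (LinearMap.range f.hom) (fun s => (hfg _).1 (h0 s))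
          refine ⟨ψ, LinearMap.ext fun s => ?_⟩
          exact congrArg Subtype.val ((LinearEquiv.ofInjective f.hom injf).apply_symm_apply
            (φ'.codRestrict (LinearMap.range f.hom) (fun s => (hfg _).1 (h0 s)) s))
        · rintro ⟨ψ, rfl⟩
          apply LinearMap.ext
          intro s
          exact hfg.apply_apply_eq_zero (ψ s)
      · intro φ ψ h
        apply LinearMap.ext
        intro s
        exact injf (LinearMap.congr_fun h s)
      · intro φ
        obtain ⟨ψ, hψ⟩ := Module.projective_lifting_property g φ (Submodule.mkQ_surjective _)
        exact ⟨ψ, hψ⟩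
    exact (hT.hasInjectiveDimensionLT_X₃_iff m hFI).1 hQ

/-- If `S` is free over `P` with a basis `v` and the Gram matrix of the form `(s, t) ↦ Φ (s * t)` is
monomial with invertible entries, then `S ≅ Hom_P(S, P)` as left `S`-modules, so the
injective dimension of `S` is at most that of `P`. -/
theorem hasInjectiveDimensionLE_of_gram {J : Type*} [Finite J] [DecidableEq J]
    (v : Module.Basis J P S) (Φ : S →ₗ[P] P) (σ : Equiv.Perm J) (c : J → Pˣ)
    (hgram : ∀ i j, Φ (v i * v j) = if j = σ i then (c i : P) else 0) (m : ℕ)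
    (h : HasInjectiveDimensionLE (ModuleCat.of P P) m) :
    HasInjectiveDimensionLE (ModuleCat.of S S) m := by
  have := Fintype.ofFinite J
  have : Module.Projective P S := Module.Projective.of_basis v
  have hgram' (i : J) (s : S) : Φ (v i * s) = c i * v.repr s (σ i) := by
    conv_lhs => rw [← v.sum_repr s]
    simp only [Finset.mul_sum, mul_smul_comm, map_sum, map_smul, hgram, smul_eq_mul, mul_ite,
      mul_zero, Finset.sum_ite_eq', Finset.mem_univ, if_true]
    exact mul_comm _ _
  let F := (ModuleCat.coextendScalars.{u, u, u} (algebraMap P S)).obj (ModuleCat.of P P)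
  let e : S ≃ₗ[P] (ModuleCat.restrictScalars (algebraMap P S)).obj (ModuleCat.of S S) :=
        { AddEquiv.refl S with map_smul' := fun r x => Algebra.smul_def r x }
  let Φ' : F := Φ ∘ₗ e.symm.toLinearMap
  let θ : S →ₗ[S] F := LinearMap.toSpanSingleton S F Φ'
  have hθ (s t : S) : (θ s : S → P) t = Φ (t * s) := rfl
  have inj : Function.Injective θ := by
    rw [injective_iff_map_eq_zero]
    intro s hs
    apply v.repr.injective
    ext i
    have h1 : Φ (v (σ.symm i) * s) = 0 := by rw [← hθ, hs]; rfl
    rw [hgram', σ.apply_symm_apply, Units.mul_right_eq_zero] at h1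
    simpa using h1
  have surj : Function.Surjective θ := by
    intro φ
    let φ' : (ModuleCat.restrictScalars (algebraMap P S)).obj (ModuleCat.of S S) →ₗ[P] P := φ
    let s : S := ∑ i, (((c i)⁻¹ : Pˣ) : P) • φ' (v i) • v (σ i)
    have hs (i : J) : v.repr s (σ i) = (((c i)⁻¹ : Pˣ) : P) • φ' (v i) := by
      simp [s, Finsupp.single_apply]
    refine ⟨s, ?_⟩
    have key : (Φ ∘ₗ LinearMap.mulRight P s) = φ' ∘ₗ e.toLinearMap := by
      refine v.ext fun i => ?_
      have := hs i
      simp only [LinearMap.comp_apply, LinearMap.mulRight_apply, hgram', this, smul_eq_mul,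
        Units.mul_inv_cancel_left]
      rfl
    exact LinearMap.ext fun t => LinearMap.congr_fun key t
  have hF := hasInjectiveDimensionLE_coextendScalars (S := S) m _ h
  exact (ModuleCat.hasInjectiveDimensionLE_iff_of_linearEquiv
    (LinearEquiv.ofBijective θ ⟨inj, surj⟩ : ModuleCat.of S S ≃ₗ[S] F) m).2 hF

/-- The hypothesis on the Gram matrix is left-right symmetric: for the opposite ring the matrix is
transposed, which is again monomial for the involution `σ`. -/
theorem isGorenstein_of_gram [IsNoetherianRing P] {J : Type*} [Finite J] [DecidableEq J]
    (v : Module.Basis J P S) (Φ : S →ₗ[P] P) (σ : Equiv.Perm J) (hσ : ∀ j, σ (σ j) = j)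
    (c : J → Pˣ) (hgram : ∀ i j, Φ (v i * v j) = if j = σ i then (c i : P) else 0) (m : ℕ)
    (h : HasInjectiveDimensionLE (ModuleCat.of P P) m) : IsGorenstein S := by
  have hfin : Module.Finite P S := Module.Finite.of_basis v
  let o : S ≃ₗ[P] Sᵐᵒᵖ := MulOpposite.opLinearEquiv P
  have hfin' : Module.Finite P Sᵐᵒᵖ := Module.Finite.equiv o
  refine ⟨IsNoetherianRing.of_finite P S, IsNoetherianRing.of_finite P Sᵐᵒᵖ,
    ⟨m, hasInjectiveDimensionLE_of_gram v Φ σ c hgram m h⟩, ⟨m, ?_⟩⟩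
  have hop := hasInjectiveDimensionLE_of_gram (v.map o) (Φ ∘ₗ o.symm.toLinearMap) σ
    (fun i => c (σ i)) (fun i j => ?_) m h
  · let e : ModuleCat.of Sᵐᵒᵖ Sᵐᵒᵖ ≃ₗ[Sᵐᵒᵖ] ModuleCat.of Sᵐᵒᵖ S :=
      { MulOpposite.opAddEquiv.symm with map_smul' := fun _ _ => rfl }
    exact (ModuleCat.hasInjectiveDimensionLE_iff_of_linearEquiv e m).1 hop
  · have h1 : (Φ ∘ₗ o.symm.toLinearMap) (v.map o i * v.map o j) = Φ (v j * v i) := by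
      simp [o]
    rw [h1, hgram]
    by_cases hij : i = σ j
    · rw [if_pos hij, if_pos (by rw [hij, hσ]), hij, hσ]
    · rw [if_neg hij, if_neg (fun h => hij (by rw [h, hσ]))]

end Coextension

/-! ### Graded pieces spanned by basis elements -/

section GradedBasis

variable {k : Type*} [Field k] {V : Type*} [AddCommGroup V] [Module k V] {ι : Type*}
  (b : Module.Basis ι k V) (deg : ι → ℤ) {𝒜 : ℤ → Submodule k V}

theorem isInternal_of_basis (h : ∀ d, 𝒜 d = Submodule.span k (b '' {i | deg i = d})) :
    DirectSum.IsInternal 𝒜 := by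
  rw [DirectSum.isInternal_submodule_iff_iSupIndep_and_iSup_eq_top]
  constructor
  · intro d
    have hle : ⨆ e, ⨆ (_ : e ≠ d), 𝒜 e ≤ Submodule.span k (b '' {i | deg i ≠ d}) := by
      refine iSup₂_le fun e he => ?_
      rw [h]
      refine Submodule.span_mono (Set.image_mono ?_)
      rintro i rfl
      exact he
    refine Disjoint.mono_right hle ?_
    rw [h]
    exact b.linearIndependent.disjoint_span_image
      (Set.disjoint_left.2 fun i hi hi' => hi' hi)
  · rw [eq_top_iff, ← b.span_eq, Submodule.span_le]
    rintro _ ⟨i, rfl⟩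
    refine Submodule.mem_iSup_of_mem (deg i) ?_
    rw [h]
    exact Submodule.subset_span ⟨i, rfl, rfl⟩

theorem finrank_of_basis (d : ℤ) (h : 𝒜 d = Submodule.span k (b '' {i | deg i = d}))
    (hfin : {i | deg i = d}.Finite) :
    Module.Finite k (𝒜 d) ∧ Module.finrank k (𝒜 d) = {i | deg i = d}.ncard := by
  have := hfin.fintype
  have hr : Set.range (fun i : {i | deg i = d} => b i) = b '' {i | deg i = d} := by
    rw [Set.image_eq_range]
  constructor
  · rw [h]
    exact Module.Finite.iff_fg.2 (Submodule.fg_span (hfin.image b))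
  · have hli : LinearIndependent k (fun i : {i | deg i = d} => b i) :=
      b.linearIndependent.comp _ Subtype.val_injective
    rw [h, ← hr, finrank_span_eq_card hli, Set.ncard_eq_toFinset_card', Set.toFinset_card]

end GradedBasis

/-! ### Algebras that are free over a polynomial ring -/

section PolynomialBasis

open MvPolynomial

variable {k : Type u} [Field k] {n : ℕ}

/-- A family `v` is a basis over a polynomial ring as soon as its multiples by monomials are a basis
over the field of coefficients. -/
theorem exists_basis_of_monomial_smul {A : Type*} [AddCommGroup A] [Module k A]
    [Module (MvPolynomial (Fin n) k) A] [IsScalarTower k (MvPolynomial (Fin n) k) A] {J : Type*}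
    (v : J → A) (e : Module.Basis ((Fin n →₀ ℕ) × J) k A)
    (he : ∀ m j, e (m, j) = monomial m (1 : k) • v j) :
    ∃ b : Module.Basis J (MvPolynomial (Fin n) k) A, ∀ j, b j = v j := by
  let L := Finsupp.linearCombination (MvPolynomial (Fin n) k) v
  let e₀ : Module.Basis (Σ _ : J, (Fin n →₀ ℕ)) k (J →₀ MvPolynomial (Fin n) k) :=
    Finsupp.basis fun _ => basisMonomials (Fin n) k
  let e₁ : Module.Basis (Σ _ : J, (Fin n →₀ ℕ)) k A :=
    e.reindex ((Equiv.prodComm _ _).trans (Equiv.sigmaEquivProd _ _).symm)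
  have hL : L.restrictScalars k = (e₀.equiv e₁ (Equiv.refl _)).toLinearMap := by
    refine e₀.ext fun ⟨j, m⟩ => ?_
    have h₀ : e₀ ⟨j, m⟩ = Finsupp.single j (monomial m 1) := by simp [e₀, Finsupp.coe_basis]
    rw [LinearEquiv.coe_coe, Module.Basis.equiv_apply, h₀]
    simp [e₁, L, he]
  have hbij : Function.Bijective L := by
    have : (L : (J →₀ MvPolynomial (Fin n) k) → A) = e₀.equiv e₁ (Equiv.refl _) :=
      congrArg DFunLike.coe hL
    rw [this]
    exact LinearEquiv.bijective _
  refine ⟨⟨(LinearEquiv.ofBijective L hbij).symm⟩, fun j => ?_⟩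
  change LinearEquiv.ofBijective L hbij (Finsupp.single j 1) = v j
  simp [L]

variable {A : Type u} [Ring A] [Algebra k A] [Algebra (MvPolynomial (Fin n) k) A]
  [IsScalarTower k (MvPolynomial (Fin n) k) A]

variable (A) in
/-- The central element by which the variable `X i` acts on an algebra over a polynomial ring. -/
def param (i : Fin n) : Subalgebra.center k A :=
  ⟨algebraMap (MvPolynomial (Fin n) k) A (X i),
    Subalgebra.mem_center_iff.2 fun b => (Algebra.commutes _ b).symm⟩

theorem coe_aeval_param (f : MvPolynomial (Fin n) k) :
    ((aeval (param (k := k) A) f : Subalgebra.center k A) : A) =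
      algebraMap (MvPolynomial (Fin n) k) A f := by
  have : (Subalgebra.center k A).val.comp (aeval (param (k := k) A)) =
      IsScalarTower.toAlgHom k (MvPolynomial (Fin n) k) A := by
    refine MvPolynomial.algHom_ext fun i => ?_
    simp [param]
  exact DFunLike.congr_fun this f

variable {J : Type*}

theorem algebraicIndependent_param (v : Module.Basis J (MvPolynomial (Fin n) k) A) [Nonempty J] :
    AlgebraicIndependent k (param (k := k) (n := n) A) := by
  have hinj : Function.Injective (algebraMap (MvPolynomial (Fin n) k) A) := by
    rw [injective_iff_map_eq_zero]
    intro f hf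
    obtain ⟨j⟩ := ‹Nonempty J›
    have h : f • v j = 0 := by rw [Algebra.smul_def, hf, zero_mul]
    simpa using congrArg (fun a => v.repr a j) h
  intro f g hfg
  apply hinj
  rw [← coe_aeval_param, ← coe_aeval_param]
  exact congrArg Subtype.val hfg

variable [Fintype J] (v : Module.Basis J (MvPolynomial (Fin n) k) A)

include v in
theorem finite_adjoin_param :
    Module.Finite (Algebra.adjoin k (Set.range (param (k := k) (n := n) A))) A := by
  classical
  refine ⟨⟨Finset.univ.image v, ?_⟩⟩
  rw [eq_top_iff]
  rintro a -
  rw [← v.sum_repr a]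
  refine Submodule.sum_mem _ fun j _ => ?_
  have hmem : aeval (param (k := k) A) (v.repr a j) ∈
      Algebra.adjoin k (Set.range (param (k := k) (n := n) A)) := by
    rw [Algebra.adjoin_range_eq_range_aeval]
    exact ⟨_, rfl⟩
  have hs : v.repr a j • v j =
      (⟨_, hmem⟩ : Algebra.adjoin k (Set.range (param (k := k) (n := n) A))) • v j := by
    rw [Algebra.smul_def, ← coe_aeval_param]
    rfl
  rw [hs]
  exact Submodule.smul_mem _ _ (Submodule.subset_span (by simp))

theorem isWeaklyRegular_X :
    RingTheory.Sequence.IsWeaklyRegular (MvPolynomial (Fin n) k)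
      (List.ofFn (X : Fin n → MvPolynomial (Fin n) k)) := by
  rw [RingTheory.Sequence.isWeaklyRegular_iff]
  intro i hi
  have hin : i < n := by simpa using hi
  have hI : (Ideal.ofList ((List.ofFn (X : Fin n → MvPolynomial (Fin n) k)).take i) •
      (⊤ : Submodule (MvPolynomial (Fin n) k) (MvPolynomial (Fin n) k))) =
      Ideal.span (X '' {j : Fin n | j.val < i}) := by
    rw [smul_eq_mul, Ideal.mul_top, Ideal.ofList]
    congr 1
    ext f
    simp only [Set.mem_ofPred_eq, Set.mem_image, List.mem_take_iff_getElem, List.getElem_ofFn,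
      List.length_ofFn]
    constructor
    · rintro ⟨j, hj, rfl⟩
      exact ⟨⟨j, by omega⟩, by change j < i; omega, rfl⟩
    · rintro ⟨j, hj, rfl⟩
      exact ⟨j, by change j.val < i at hj; omega, rfl⟩
  rw [hI, List.getElem_ofFn, isSMulRegular_quotient_iff_mem_of_smul_mem]
  intro f hf
  rw [smul_eq_mul, mem_ideal_span_X_image] at hf
  rw [mem_ideal_span_X_image]
  intro m hm
  obtain ⟨j, hj, hj'⟩ := hf (Finsupp.single ⟨i, hin⟩ 1 + m) (by
    rw [mem_support_iff, coeff_X_mul]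
    exact mem_support_iff.1 hm)
  refine ⟨j, hj, ?_⟩
  have hne : (⟨i, hin⟩ : Fin n) ≠ j := by
    rintro rfl
    exact lt_irrefl i hj
  simpa [Finsupp.single_apply, hne] using hj'

omit [IsScalarTower k (MvPolynomial (Fin n) k) A] in
/-- The ideal generated by the parameters consists of the elements all of whose coordinates have
vanishing constant coefficient. -/
theorem mem_centralIdeal_param (a : A) :
    a ∈ centralIdeal (param (k := k) (n := n) A) ↔ ∀ j, constantCoeff (v.repr a j) = 0 := by
  constructor
  · intro ha
    induction ha using Submodule.span_induction with
    | mem x hx =>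
      obtain ⟨i, rfl⟩ := hx
      intro j
      have : (param (k := k) A i : A) = (X i : MvPolynomial (Fin n) k) • (1 : A) := by
        rw [Algebra.smul_def, mul_one]; rfl
      simp [this]
    | zero => simp
    | add x z _ _ hx hz => intro j; simp [hx j, hz j]
    | smul c x hx ih =>
      -- left multiplication by `c` is linear over the polynomial ring, whose image is central
      intro j
      have : v.repr (c * x) j = ∑ i, v.repr x i * v.repr (c * v i) j := by
        conv_lhs => rw [← v.sum_repr x, Finset.mul_sum, map_sum, Finsupp.finsetSum_apply]
        simp only [mul_smul_comm, map_smul, Finsupp.smul_apply, smul_eq_mul]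
      rw [smul_eq_mul, this, map_sum]
      exact Finset.sum_eq_zero fun i _ => by rw [map_mul, ih, zero_mul]
  · intro h
    rw [← v.sum_repr a]
    refine Submodule.sum_mem _ fun j _ => ?_
    have hj : v.repr a j ∈ Ideal.span (X '' Set.univ : Set (MvPolynomial (Fin n) k)) := by
      rw [mem_ideal_span_X_image]
      intro m hm
      by_contra! hm'
      have h0 : m = 0 := Finsupp.ext fun i => hm' i trivial
      rw [h0, mem_support_iff] at hm
      exact hm (h j)
    have hle : Ideal.span (X '' Set.univ) ≤ (centralIdeal (param (k := k) (n := n) A)).comap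
        (algebraMap (MvPolynomial (Fin n) k) A) := by
      rw [Ideal.span_le]
      rintro _ ⟨i, -, rfl⟩
      exact Ideal.subset_span ⟨i, rfl⟩
    rw [Algebra.smul_def]
    exact Ideal.mul_mem_right _ _ (hle hj)

/-- The basis of the quotient by the parameters which is induced by a basis over the polynomial
ring. -/
def quotientBasis : Module.Basis J k (A ⧸ centralIdeal (param (k := k) (n := n) A)) :=
  let q : A →ₗ[k] (J →₀ k) :=
    Finsupp.mapRange.linearMap (lcoeff k 0) ∘ₗ v.repr.toLinearMap.restrictScalars k
  ⟨(Submodule.Quotient.restrictScalarsEquiv k _).symm ≪≫ₗ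
    Submodule.quotEquivOfEq _ (LinearMap.ker q) (by
      ext a
      rw [Submodule.restrictScalars_mem, mem_centralIdeal_param v, LinearMap.mem_ker,
        Finsupp.ext_iff]
      rfl) ≪≫ₗ
    q.quotKerEquivOfSurjective (fun f => ⟨v.repr.symm (Finsupp.mapRange C (map_zero C) f), by
      ext j
      simp [q]⟩)⟩

theorem quotientBasis_repr_mk (a : A) (j : J) :
    (quotientBasis v).repr (Ideal.Quotient.mk (centralIdeal (param (k := k) A)) a) j =
      constantCoeff (v.repr a j) := rfl

theorem quotientBasis_apply (j : J) :
    quotientBasis v j = Ideal.Quotient.mk (centralIdeal (param (k := k) A)) (v j) := by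
  classical
  apply (quotientBasis v).repr.injective
  ext i
  rw [quotientBasis_repr_mk]
  simp [Finsupp.single_apply, apply_ite]

include v in
/-- The variables are a regular sequence of the polynomial ring, hence of every free module over it. -/
theorem isRegular_param [Nonempty J] :
    RingTheory.Sequence.IsRegular A (List.ofFn (param (k := k) (n := n) A)) := by
  let φ : MvPolynomial (Fin n) k →+* Subalgebra.center k A := (aeval (param (k := k) A)).toRingHom
  have hsmul (f : MvPolynomial (Fin n) k) (a : A) : φ f • a = f • a := by
    rw [Algebra.smul_def, ← coe_aeval_param]
    rfl
  have hmap : List.ofFn (param (k := k) (n := n) A) =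
      (List.ofFn (X : Fin n → MvPolynomial (Fin n) k)).map φ := by
    rw [List.map_ofFn]
    congr 1
    funext i
    exact (aeval_X _ i).symm
  have hfree : Module.Free (MvPolynomial (Fin n) k) A := Module.Free.of_basis v
  have hweak := (isWeaklyRegular_X (k := k) (n := n)).isWeaklyRegular_lTensor (M₂ := A)
  rw [(TensorProduct.rid (MvPolynomial (Fin n) k) A).isWeaklyRegular_congr] at hweak
  refine ⟨?_, fun htop => ?_⟩
  · rw [hmap]
    refine ((AddEquiv.refl A).isWeaklyRegular_congr ?_).1 hweak
    exact List.forall₂_map_right_iff.2 (List.forall₂_same.2 fun f _ a => (hsmul f a).symm)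
  · have hle : ((Ideal.ofList (List.ofFn (param (k := k) (n := n) A)) •
        (⊤ : Submodule (Subalgebra.center k A) A) : Submodule (Subalgebra.center k A) A) : Set A) ⊆
        centralIdeal (param (k := k) (n := n) A) := by
      intro a ha
      refine Submodule.smul_induction_on (p := fun a => a ∈ centralIdeal (param (k := k) A)) ha
        (fun r hr b _ => ?_) (fun _ _ => Submodule.add_mem _)
      have hr' : (r : A) ∈ centralIdeal (param (k := k) (n := n) A) := by
        refine (Ideal.span_le (I := (centralIdeal (param (k := k) A)).comap
          (Subalgebra.center k A).subtype)).2 ?_ hr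
        intro x hx
        obtain ⟨i, rfl⟩ := List.mem_ofFn.1 hx
        exact Ideal.subset_span ⟨i, rfl⟩
      exact Ideal.mul_mem_right b _ hr'
    obtain ⟨j⟩ := ‹Nonempty J›
    have hj : v j ∈ centralIdeal (param (k := k) (n := n) A) := hle (by rw [← htop]; trivial)
    have := (mem_centralIdeal_param v _).1 hj j
    simp at this

/-! ### The quotient by the parameters -/

section Graded

variable (wt : Fin n → ℕ) (dJ : J → ℕ)

/-- The degree of the basis element `y^m v_j`, if `y_i` has degree `wt i` and `v_j` has degree
`dJ j`. -/
def wdeg (t : (Fin n →₀ ℕ) × J) : ℕ := ∑ i, t.1 i * wt i + dJ t.2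

/-- The basis `y^m v_j` over the field of coefficients. -/
def monomialBasis : Module.Basis ((Fin n →₀ ℕ) × J) k A := (basisMonomials (Fin n) k).smulTower v

omit [Fintype J] in
theorem monomialBasis_apply (t : (Fin n →₀ ℕ) × J) :
    monomialBasis v t = monomial t.1 (1 : k) • v t.2 := by
  simp [monomialBasis, Module.Basis.smulTower_apply]

variable {𝒜 : ℤ → Submodule k A}
  (h𝒜 : ∀ d, 𝒜 d = Submodule.span k (monomialBasis v '' {t | (wdeg wt dJ t : ℤ) = d}))

theorem quotientBasis_mk_monomialBasis (t : (Fin n →₀ ℕ) × J) :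
    Ideal.Quotient.mk (centralIdeal (param (k := k) A)) (monomialBasis v t) =
      if t.1 = 0 then quotientBasis v t.2 else 0 := by
  classical
  apply (quotientBasis v).repr.injective
  ext i
  rw [quotientBasis_repr_mk, monomialBasis_apply]
  split_ifs with h
  · simp [h, Finsupp.single_apply, apply_ite]
  · simp [Finsupp.single_apply, apply_ite, constantCoeff_monomial, h]

include h𝒜 in
theorem quotientPiece_eq_span (d : ℤ) :
    quotientPiece 𝒜 (centralIdeal (param (k := k) (n := n) A)) d =
      Submodule.span k (quotientBasis v '' {j | (dJ j : ℤ) = d}) := by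
  rw [quotientPiece, h𝒜, Submodule.map_span]
  apply le_antisymm
  · rw [Submodule.span_le]
    rintro _ ⟨_, ⟨t, ht, rfl⟩, rfl⟩
    change Ideal.Quotient.mk _ (monomialBasis v t) ∈ _
    rw [quotientBasis_mk_monomialBasis]
    split_ifs with h
    · refine Submodule.subset_span ⟨t.2, ?_, rfl⟩
      simpa [wdeg, h] using ht
    · exact zero_mem _
  · refine Submodule.span_mono ?_
    rintro _ ⟨j, hj, rfl⟩
    refine ⟨_, ⟨(0, j), by simpa [wdeg] using hj, rfl⟩, ?_⟩
    exact (quotientBasis_mk_monomialBasis v (0, j)).trans (if_pos rfl)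

theorem gradedMonoid_quotientPiece {B : Type u} [Ring B] [Algebra k B] (ℬ : ℤ → Submodule k B)
    [SetLike.GradedMonoid ℬ] (I : Ideal B) [I.IsTwoSided] :
    SetLike.GradedMonoid (quotientPiece ℬ I) where
  one_mem := ⟨1, SetLike.GradedOne.one_mem, map_one (Ideal.Quotient.mkₐ k I)⟩
  mul_mem := by
    rintro i j _ _ ⟨a, ha, rfl⟩ ⟨b, hb, rfl⟩
    exact ⟨a * b, SetLike.GradedMul.mul_mem ha hb, map_mul (Ideal.Quotient.mkₐ k I) a b⟩

theorem gradedAlgebra_of_isInternal {B : Type*} [Ring B] [Algebra k B] (ℬ : ℤ → Submodule k B)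
    [SetLike.GradedMonoid ℬ] (h : DirectSum.IsInternal ℬ) : Nonempty (GradedAlgebra ℬ) :=
  ⟨{ h.chooseDecomposition with }⟩

include h𝒜 in
/-- If the form `(a, b) ↦ Φ (a * b)` has a monomial Gram matrix, where `Φ` takes the coefficient of
the basis element `v ω` of top degree, then the quotient by the parameters is a graded Frobenius
algebra. -/
theorem isGradedFrobenius_quotient [DecidableEq J] [SetLike.GradedMonoid 𝒜] (ω : J)
    (hω : ∀ j, dJ j = dJ ω ↔ j = ω) (σ : Equiv.Perm J) (c : J → kˣ)
    (hgram : ∀ i j, constantCoeff (v.repr (v i * v j) ω) = if j = σ i then (c i : k) else 0)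
    (α : A) (u : kˣ) (hα : α = u • v ω) :
    IsGradedFrobenius (quotientPiece 𝒜 (centralIdeal (param (k := k) (n := n) A))) (dJ ω)
      (Ideal.Quotient.mk (centralIdeal (param (k := k) A)) α) := by
  have hα' : Ideal.Quotient.mk (centralIdeal (param (k := k) A)) α =
      (u : k) • quotientBasis v ω := by
    rw [quotientBasis_apply, hα]
    rfl
  have hp := quotientPiece_eq_span v wt dJ h𝒜
  have := gradedMonoid_quotientPiece 𝒜 (centralIdeal (param (k := k) (n := n) A))
  -- the form is normalized to take the value one on the image of `α = u • v ω`
  let φ := (u⁻¹ : kˣ) • (quotientBasis v).coord ω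
  have hφ (i j : J) : φ (quotientBasis v i * quotientBasis v j) =
      if j = σ i then ((u⁻¹ * c i : kˣ) : k) else 0 := by
    have h1 : quotientBasis v i * quotientBasis v j =
        Ideal.Quotient.mk (centralIdeal (param (k := k) A)) (v i * v j) := by
      rw [quotientBasis_apply, quotientBasis_apply, map_mul]
    have h2 : φ (quotientBasis v i * quotientBasis v j) =
        ((u⁻¹ : kˣ) : k) * constantCoeff (v.repr (v i * v j) ω) := by
      rw [h1, ← quotientBasis_repr_mk]
      rfl
    rw [h2, hgram]
    split_ifs
    · simp
    · simp
  refine ⟨Module.Finite.of_basis (quotientBasis v), ?_, ?_, ?_, φ, ?_, ?_, ?_, ?_⟩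
  · exact gradedAlgebra_of_isInternal _
      (isInternal_of_basis (quotientBasis v) (fun j => (dJ j : ℤ)) hp)
  · rw [hα']
    exact smul_ne_zero u.ne_zero ((quotientBasis v).ne_zero ω)
  · have : {j | (dJ j : ℤ) = dJ ω} = {ω} := by
      ext j
      simp [hω]
    rw [hp, this, Set.image_singleton, hα', Submodule.span_singleton_smul_eq u.isUnit]
  · rw [hα']
    simp [φ, Units.smul_def]
  · intro d hd b hb
    rw [hp] at hb
    induction hb using Submodule.span_induction with
    | mem x hx =>
      obtain ⟨j, hj, rfl⟩ := hx
      have : j ≠ ω := by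
        rintro rfl
        exact hd hj.symm
      simp [φ, this]
    | zero => simp
    | add x y _ _ hx hy => rw [map_add, hx, hy, add_zero]
    | smul a x _ hx => rw [map_smul, hx, smul_zero]
  · intro a ha
    apply (quotientBasis v).repr.injective
    ext i
    have h1 := ha (quotientBasis v (σ i))
    rw [← (quotientBasis v).sum_repr a, Finset.sum_mul, map_sum] at h1
    simp only [smul_mul_assoc, map_smul, hφ, σ.injective.eq_iff, smul_eq_mul, mul_ite, mul_zero,
      Finset.sum_ite_eq, Finset.mem_univ, if_true] at h1
    simpa using h1
  · intro b hb
    apply (quotientBasis v).repr.injective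
    ext i
    have h1 := hb (quotientBasis v (σ.symm i))
    rw [← (quotientBasis v).sum_repr b, Finset.mul_sum, map_sum] at h1
    simp only [mul_smul_comm, map_smul, hφ, σ.apply_symm_apply, smul_eq_mul, mul_ite, mul_zero,
      Finset.sum_ite_eq', Finset.mem_univ, if_true] at h1
    simpa using h1

end Graded

end PolynomialBasis

/-! ### Counting monomials and the functional equation -/

section Poincare

variable {n : ℕ} {J : Type*} [Fintype J] (wt : Fin n → ℕ) (dJ : J → ℕ)

theorem finite_wdeg_eq (hwt : ∀ i, 0 < wt i) (d : ℕ) :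
    {t : (Fin n →₀ ℕ) × J | wdeg wt dJ t = d}.Finite := by
  have h1 : {m : Fin n →₀ ℕ | ∀ i, m i ≤ d}.Finite := by
    refine (Set.finite_Iic (Finsupp.equivFunOnFinite.symm fun _ : Fin n => d)).subset fun m hm i => ?_
    exact hm i
  refine (h1.prod (Set.finite_univ (α := J))).subset ?_
  rintro ⟨m, j⟩ h
  refine ⟨fun i => ?_, trivial⟩
  change m i ≤ d
  have h2 : m i * wt i ≤ ∑ i, m i * wt i :=
    Finset.single_le_sum (f := fun i => m i * wt i) (fun _ _ => Nat.zero_le _) (Finset.mem_univ i)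
  have h3 : m i ≤ m i * wt i := Nat.le_mul_of_pos_right _ (hwt i)
  change ∑ i, m i * wt i + dJ j = d at h
  omega

/-- The series `∑ q^d #{(m, j) : deg (y^m v_j) = d, m_i = 0 for i ∈ s}`. -/
def countSeries (s : Finset (Fin n)) : PowerSeries ℚ :=
  PowerSeries.mk fun d =>
    ({t : (Fin n →₀ ℕ) × J | (∀ i ∈ s, t.1 i = 0) ∧ wdeg wt dJ t = d}.ncard : ℚ)

omit [Fintype J] in
theorem wdeg_add_single (m : Fin n →₀ ℕ) (i : Fin n) (j : J) :
    wdeg wt dJ (m + Finsupp.single i 1, j) = wdeg wt dJ (m, j) + wt i := by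
  simp only [wdeg, Finsupp.add_apply, add_mul, Finset.sum_add_distrib]
  have : ∑ l, (Finsupp.single i 1 : Fin n →₀ ℕ) l * wt l = wt i := by
    simp [Finsupp.single_apply]
  omega

/-- Multiplication by `1 - q^{deg y_i}` removes the monomials that are divisible by `y_i`. -/
theorem one_sub_mul_countSeries (hwt : ∀ i, 0 < wt i) (s : Finset (Fin n)) (i : Fin n)
    (hi : i ∉ s) :
    (1 - PowerSeries.X ^ wt i) * countSeries wt dJ s = countSeries wt dJ (insert i s) := by
  rw [sub_mul, one_mul, sub_eq_iff_eq_add]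
  ext d
  rw [map_add, PowerSeries.coeff_X_pow_mul']
  simp only [countSeries, PowerSeries.coeff_mk]
  set U := {t : (Fin n →₀ ℕ) × J | (∀ l ∈ s, t.1 l = 0) ∧ wdeg wt dJ t = d}
  set V := {t : (Fin n →₀ ℕ) × J | (∀ l ∈ insert i s, t.1 l = 0) ∧ wdeg wt dJ t = d}
  have hfin (e : ℕ) (s : Finset (Fin n)) :
      {t : (Fin n →₀ ℕ) × J | (∀ l ∈ s, t.1 l = 0) ∧ wdeg wt dJ t = e}.Finite :=
    (finite_wdeg_eq wt dJ hwt e).subset fun t ht => ht.2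
  -- an exponent vector with nonzero `i`-th entry is another one shifted by the `i`-th unit vector
  let sh : (Fin n →₀ ℕ) × J → (Fin n →₀ ℕ) × J := fun t => (t.1 + Finsupp.single i 1, t.2)
  have hsh : Function.Injective sh := fun t t' h => by
    simp only [sh, Prod.mk.injEq, add_left_inj] at h
    exact Prod.ext h.1 h.2
  have hsplit : U = V ∪ sh '' {t | (∀ l ∈ s, t.1 l = 0) ∧ wdeg wt dJ t + wt i = d} := by
    ext ⟨m, j⟩
    constructor
    · rintro ⟨h1, h2⟩
      by_cases hm : m i = 0
      · exact Or.inl ⟨fun l hl => (Finset.mem_insert.1 hl).elim (fun h => h ▸ hm) (h1 l), h2⟩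
      · have hle : Finsupp.single i 1 ≤ m := by
          rw [Finsupp.single_le_iff]; omega
        have hsub : m - Finsupp.single i 1 + Finsupp.single i 1 = m := tsub_add_cancel_of_le hle
        refine Or.inr ⟨(m - Finsupp.single i 1, j), ⟨fun l hl => ?_, ?_⟩, ?_⟩
        · have := h1 l hl
          simp only [Finsupp.tsub_apply] at this ⊢
          omega
        · rw [← wdeg_add_single, hsub]
          exact h2
        · exact Prod.ext hsub rfl
    · rintro (⟨h1, h2⟩ | ⟨⟨m', j'⟩, ⟨h1, h2⟩, h⟩)
      · exact ⟨fun l hl => h1 l (Finset.mem_insert_of_mem hl), h2⟩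
      · rw [← h]
        refine ⟨fun l hl => ?_, (wdeg_add_single wt dJ m' i j').trans h2⟩
        have hne : i ≠ l := fun h => hi (h ▸ hl)
        simpa [sh, Finsupp.single_apply, hne] using h1 l hl
  have hdisj : Disjoint V (sh '' {t | (∀ l ∈ s, t.1 l = 0) ∧ wdeg wt dJ t + wt i = d}) := by
    rw [Set.disjoint_left]
    rintro _ ⟨h1, -⟩ ⟨t, -, rfl⟩
    have := h1 i (Finset.mem_insert_self i s)
    simp [sh] at this
  have hfin2 : {t : (Fin n →₀ ℕ) × J |
      (∀ l ∈ s, t.1 l = 0) ∧ wdeg wt dJ t + wt i = d}.Finite :=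
    (hfin (d - wt i) s).subset fun t ht => ⟨ht.1, by have := ht.2; omega⟩
  rw [hsplit, Set.ncard_union_eq hdisj (hfin d _) (hfin2.image sh),
    Set.ncard_image_of_injective _ hsh]
  push_cast
  congr 1
  split_ifs with hd
  · congr 2
    ext t
    simp only [Set.mem_ofPred_eq]
    refine and_congr_right fun _ => ?_
    omega
  · have : {t : (Fin n →₀ ℕ) × J | (∀ l ∈ s, t.1 l = 0) ∧ wdeg wt dJ t + wt i = d} = ∅ := by
      refine Set.eq_empty_of_forall_notMem fun t ht => ?_
      have := ht.2
      omega
    rw [this, Set.ncard_empty, Nat.cast_zero]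

theorem countSeries_univ :
    countSeries wt dJ Finset.univ = ∑ j, (PowerSeries.X : PowerSeries ℚ) ^ dJ j := by
  classical
  ext d
  rw [map_sum, countSeries, PowerSeries.coeff_mk]
  simp only [PowerSeries.coeff_X_pow]
  have : {t : (Fin n →₀ ℕ) × J | (∀ i ∈ Finset.univ, t.1 i = 0) ∧ wdeg wt dJ t = d} =
      (fun j => ((0 : Fin n →₀ ℕ), j)) '' {j | d = dJ j} := by
    ext ⟨m, j⟩
    constructor
    · rintro ⟨h1, h2⟩
      have h0 : m = 0 := Finsupp.ext fun i => h1 i (Finset.mem_univ i)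
      subst h0
      exact ⟨j, by simpa [wdeg, eq_comm] using h2, rfl⟩
    · rintro ⟨j', h, hj⟩
      rw [← hj]
      exact ⟨fun _ _ => rfl, by simpa [wdeg, eq_comm] using h⟩
  rw [this, Set.ncard_image_of_injective _ (Prod.mk_right_injective 0),
    Set.ncard_eq_toFinset_card', Finset.sum_boole]
  simp

theorem prod_mul_countSeries (hwt : ∀ i, 0 < wt i) :
    (∏ i, (1 - PowerSeries.X ^ wt i)) * countSeries wt dJ ∅ =
      ∑ j, (PowerSeries.X : PowerSeries ℚ) ^ dJ j := by
  rw [← countSeries_univ wt]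
  induction (Finset.univ : Finset (Fin n)) using Finset.induction_on with
  | empty => rw [Finset.prod_empty, one_mul]
  | insert i s hi ih =>
    rw [Finset.prod_insert hi, mul_assoc, ih, one_sub_mul_countSeries wt dJ hwt s i hi]

/-- The numerator `∑_j q^{deg v_j}` of the Poincaré series. -/
def numer : Polynomial ℚ := ∑ j, Polynomial.X ^ dJ j

/-- The denominator `∏_i (1 - q^{deg y_i})` of the Poincaré series. -/
def denom : Polynomial ℚ := ∏ i, (1 - Polynomial.X ^ wt i)

theorem denom_ne_zero (hwt : ∀ i, 0 < wt i) : denom wt ≠ 0 := by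
  refine Finset.prod_ne_zero_iff.2 fun i _ h => ?_
  have := congrArg (Polynomial.coeff · 0) h
  simp [Polynomial.coeff_X_pow, (hwt i).ne] at this

theorem coe_algebraMap_div {K : Type*} [Field K] (p q : Polynomial K) (hq : q ≠ 0)
    (f : PowerSeries K) (h : (p : PowerSeries K) = q * f) :
    ((algebraMap _ (RatFunc K) p / algebraMap _ (RatFunc K) q : RatFunc K) : LaurentSeries K) =
      (f : LaurentSeries K) := by
  rw [map_div₀, div_eq_iff ((map_ne_zero _).2 (RatFunc.algebraMap_ne_zero hq)),
    ← RatFunc.coePolynomial_eq_algebraMap, ← RatFunc.coePolynomial_eq_algebraMap,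
    ← RatFunc.coe_coe, ← RatFunc.coe_coe, h, mul_comm]
  exact map_mul (HahnSeries.ofPowerSeries ℤ K) _ _

theorem coe_numer_div_denom (hwt : ∀ i, 0 < wt i) :
    ((algebraMap _ (RatFunc ℚ) (numer dJ) / algebraMap _ (RatFunc ℚ) (denom wt) : RatFunc ℚ) :
      LaurentSeries ℚ) = (countSeries wt dJ ∅ : LaurentSeries ℚ) := by
  refine coe_algebraMap_div _ _ (denom_ne_zero wt hwt) _ ?_
  have h1 : ((numer dJ : Polynomial ℚ) : PowerSeries ℚ) = ∑ j, PowerSeries.X ^ dJ j := by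
    rw [numer, ← Polynomial.coeToPowerSeries.ringHom_apply, map_sum]
    simp
  have h2 : ((denom wt : Polynomial ℚ) : PowerSeries ℚ) =
      ∏ i, (1 - PowerSeries.X ^ wt i) := by
    rw [denom, ← Polynomial.coeToPowerSeries.ringHom_apply, map_prod]
    simp
  rw [h1, h2, prod_mul_countSeries wt dJ hwt]

/-- `RatFunc.eval` is defined by the reduced fraction; it may be computed from any fraction whose
denominator does not vanish at the given point. -/
theorem eval_algebraMap_div {K L : Type u} [Field K] [Field L] (f : K →+* L) (a : L)
    (p q : Polynomial K) (hq : q.eval₂ f a ≠ 0) :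
    RatFunc.eval f a (algebraMap _ (RatFunc K) p / algebraMap _ (RatFunc K) q) =
      p.eval₂ f a / q.eval₂ f a := by
  have hq0 : q ≠ 0 := by
    rintro rfl
    simp at hq
  set g : RatFunc K := algebraMap _ (RatFunc K) p / algebraMap _ (RatFunc K) q with hg
  have h1 : g.num * q = p * g.denom :=
    (RatFunc.num_mul_eq_mul_denom_iff hq0).2 hg
  have hd : g.denom.eval₂ f a ≠ 0 := by
    obtain ⟨r, hr⟩ := RatFunc.denom_div_dvd p q
    rw [hr, Polynomial.eval₂_mul] at hq
    exact left_ne_zero_of_mul hq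
  rw [RatFunc.eval, div_eq_div_iff hd hq, ← Polynomial.eval₂_mul, h1, Polynomial.eval₂_mul]

/-- The functional equation of the Poincaré series. It combines the symmetry `d ↦ D - d` of the
degrees of the basis elements with `1 - q⁻ʷ = -q⁻ʷ (1 - qʷ)`. -/
theorem eval_inv_X_numer_div_denom (hwt : ∀ i, 0 < wt i) (D : ℕ) (σ : Equiv.Perm J)
    (hσ : ∀ j, dJ j + dJ (σ j) = D) (hD : D + n = ∑ i, wt i) :
    RatFunc.eval RatFunc.C (RatFunc.X⁻¹ : RatFunc ℚ)
      (algebraMap _ (RatFunc ℚ) (numer dJ) / algebraMap _ (RatFunc ℚ) (denom wt)) =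
    (-RatFunc.X) ^ n *
      (algebraMap _ (RatFunc ℚ) (numer dJ) / algebraMap _ (RatFunc ℚ) (denom wt)) := by
  have hX : (RatFunc.X : RatFunc ℚ) ≠ 0 := RatFunc.X_ne_zero
  have hd : (algebraMap _ (RatFunc ℚ) (denom wt)) ≠ 0 :=
    RatFunc.algebraMap_ne_zero (denom_ne_zero wt hwt)
  have h1 : RatFunc.X ^ D * (numer dJ).eval₂ RatFunc.C (RatFunc.X⁻¹ : RatFunc ℚ) =
      algebraMap _ (RatFunc ℚ) (numer dJ) := by
    simp only [numer, Polynomial.eval₂_finsetSum, Polynomial.eval₂_X_pow, map_sum, map_pow,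
      RatFunc.algebraMap_X, Finset.mul_sum]
    rw [← Equiv.sum_comp σ]
    refine Finset.sum_congr rfl fun j _ => ?_
    rw [← hσ j, pow_add, mul_assoc, ← mul_pow, mul_inv_cancel₀ hX, one_pow, mul_one]
  have h2 : RatFunc.X ^ (∑ i, wt i) * (denom wt).eval₂ RatFunc.C (RatFunc.X⁻¹ : RatFunc ℚ) =
      (-1) ^ n * algebraMap _ (RatFunc ℚ) (denom wt) := by
    have hn : ((-1) ^ n : RatFunc ℚ) = ∏ _i : Fin n, (-1 : RatFunc ℚ) := by simp
    rw [hn, denom, Polynomial.eval₂_finsetProd, map_prod, ← Finset.prod_pow_eq_pow_sum,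
      ← Finset.prod_mul_distrib, ← Finset.prod_mul_distrib]
    refine Finset.prod_congr rfl fun i _ => ?_
    simp only [Polynomial.eval₂_sub, Polynomial.eval₂_one, Polynomial.eval₂_X_pow, map_sub,
      map_one, map_pow, RatFunc.algebraMap_X]
    rw [mul_sub, ← mul_pow, mul_inv_cancel₀ hX]
    ring
  have hd' : (denom wt).eval₂ RatFunc.C (RatFunc.X⁻¹ : RatFunc ℚ) ≠ 0 := by
    intro h
    rw [h, mul_zero] at h2
    exact mul_ne_zero (pow_ne_zero _ (by norm_num)) hd h2.symm
  rw [eval_algebraMap_div _ _ _ _ hd', ← h1, div_eq_iff hd']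
  have h3 : (-1 : RatFunc ℚ) ^ n * (-1) ^ n = 1 := by
    rw [← mul_pow]; norm_num
  have h4 : algebraMap _ (RatFunc ℚ) (denom wt) = (-1) ^ n * (RatFunc.X ^ (D + n) *
      (denom wt).eval₂ RatFunc.C (RatFunc.X⁻¹ : RatFunc ℚ)) := by
    rw [hD, h2, ← mul_assoc, h3, one_mul]
  rw [h4, neg_pow]
  have h5 : ((-1 : RatFunc ℚ) ^ n) ≠ 0 := pow_ne_zero _ (by norm_num)
  generalize (denom wt).eval₂ RatFunc.C (RatFunc.X⁻¹ : RatFunc ℚ) = b at hd'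
  field_simp
  ring

end Poincare

/-! ### The exterior algebra -/

section Exterior

variable (k : Type u) [Field k] (n : ℕ)

/-- The basis of the exterior algebra formed by the products `ξ_I`, for `I` a set of indices. -/
def extBasis : Module.Basis (Finset (Fin n)) k (ExteriorAlgebra k (Fin n → k)) :=
  (Pi.basisFun k (Fin n)).ExteriorAlgebra

variable {k n}

theorem extBasis_empty : extBasis k n ∅ = 1 := by
  rw [extBasis, ExteriorAlgebra.basis_apply_ofCard _ (Finset.card_empty)]
  simp [ExteriorAlgebra.ιMulti_family]

theorem extBasis_singleton (i : Fin n) :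
    extBasis k n {i} = ExteriorAlgebra.ι k (Pi.single i 1) := by
  rw [extBasis, ExteriorAlgebra.basis_apply_ofCard _ (Finset.card_singleton i)]
  have hmem : (Set.powersetCard.ofFinEmbEquiv.symm
      (Set.powersetCard.ofCard (Finset.card_singleton i))) 0 = i := by
    have := (Set.powersetCard.mem_range_ofFinEmbEquiv_symm_iff_mem
      (Set.powersetCard.ofCard (Finset.card_singleton i)) _).1 ⟨0, rfl⟩
    exact Finset.mem_singleton.1 (Set.powersetCard.mem_coe_iff.1 this)
  rw [ExteriorAlgebra.ιMulti_family, ExteriorAlgebra.ιMulti_succ_apply,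
    ExteriorAlgebra.ιMulti_zero_apply, mul_one, Function.comp_apply, hmem, Pi.basisFun_apply]

theorem exists_extBasis_mul (I J : Finset (Fin n)) :
    ∃ c : k, (c ≠ 0 ↔ Disjoint I J) ∧
      extBasis k n I * extBasis k n J = c • extBasis k n (I ∪ J) := by
  let s : Set.powersetCard (Fin n) I.card := ⟨I, rfl⟩
  let t : Set.powersetCard (Fin n) J.card := ⟨J, rfl⟩
  by_cases h : Disjoint I J
  · have h' : Disjoint s.val t.val := h
    have hmul := ExteriorAlgebra.basis_mul_of_disjoint (Pi.basisFun k (Fin n)) s t h'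
    have hu : ((Set.powersetCard.disjUnion h' : Set.powersetCard (Fin n) _) : Finset (Fin n)) = I ∪ J := by
      simp [s, t]
    rw [hu] at hmul
    obtain hs | hs := Int.units_eq_one_or (Set.powersetCard.permOfDisjoint h').sign
    · refine ⟨1, by simpa using h, ?_⟩
      rw [hs, one_smul] at hmul
      rw [one_smul]
      exact hmul
    · refine ⟨-1, by simpa using h, ?_⟩
      rw [hs] at hmul
      rw [neg_smul, one_smul]
      rw [Units.smul_def, Units.val_neg, Units.val_one, neg_smul, one_smul] at hmul
      exact hmul
  · refine ⟨0, by simpa using h, ?_⟩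
    rw [zero_smul]
    exact ExteriorAlgebra.basis_mul_of_not_disjoint (Pi.basisFun k (Fin n)) s t h

theorem exists_prod_ι_eq (l : List (Fin n)) :
    ∃ c : k, (c ≠ 0 ↔ l.Nodup) ∧
      (l.map fun i => ExteriorAlgebra.ι k (Pi.single i (1 : k))).prod =
        c • extBasis k n l.toFinset := by
  induction l with
  | nil => exact ⟨1, by simp, by simp [extBasis_empty]⟩
  | cons i l ih =>
    obtain ⟨c, hc, h⟩ := ih
    obtain ⟨c', hc', h'⟩ := exists_extBasis_mul (k := k) {i} l.toFinset
    refine ⟨c * c', ?_, ?_⟩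
    · rw [mul_ne_zero_iff, hc, hc', List.nodup_cons]
      simp [and_comm]
    · rw [List.map_cons, List.prod_cons, h, ← extBasis_singleton, mul_smul_comm, h', smul_smul,
        List.toFinset_cons, Finset.insert_eq]

end Exterior

/-! ### The basis of monomials of `R` and of its integral part -/

section RBasis

variable (k : Type u) [Field k] (n : ℕ)

/-- The basis of `R` formed by the monomials `x^a ξ_I`. -/
def rBasis : Module.Basis ((Fin n →₀ ℕ) × Finset (Fin n)) k (R k n) :=
  ((MvPolynomial.basisMonomials (Fin n) k).tensorProduct (extBasis k n) :
    Module.Basis ((Fin n →₀ ℕ) × Finset (Fin n)) k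
      (MvPolynomial (Fin n) k ⊗[k] ExteriorAlgebra k (Fin n → k)))

variable {k n}

theorem rBasis_apply (a : Fin n →₀ ℕ) (I : Finset (Fin n)) :
    rBasis k n (a, I) = polyIncl k n (MvPolynomial.monomial a 1) * extIncl k n (extBasis k n I) := by
  have h1 : rBasis k n (a, I) = (MvPolynomial.monomial a 1 ⊗ₜ[k] extBasis k n I :
      MvPolynomial (Fin n) k ⊗[k] ExteriorAlgebra k (Fin n → k)) :=
    (Module.Basis.tensorProduct_apply _ _ _ _).trans (by rw [MvPolynomial.coe_basisMonomials])
  have h2 : polyIncl k n (MvPolynomial.monomial a 1) * extIncl k n (extBasis k n I) =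
      ((MvPolynomial.monomial a 1 * 1) ⊗ₜ[k] (1 * extBasis k n I) :
      MvPolynomial (Fin n) k ⊗[k] ExteriorAlgebra k (Fin n → k)) :=
    Algebra.TensorProduct.tmul_mul_tmul _ _ _ _
  rw [h1, h2, mul_one, one_mul]

theorem polyIncl_mul_rBasis (a b : Fin n →₀ ℕ) (I : Finset (Fin n)) :
    polyIncl k n (MvPolynomial.monomial a 1) * rBasis k n (b, I) = rBasis k n (a + b, I) := by
  rw [rBasis_apply, rBasis_apply, ← mul_assoc, ← map_mul, MvPolynomial.monomial_mul, one_mul]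

theorem exists_rBasis_mul (a b : Fin n →₀ ℕ) (I J : Finset (Fin n)) :
    ∃ c : k, (c ≠ 0 ↔ Disjoint I J) ∧
      rBasis k n (a, I) * rBasis k n (b, J) = c • rBasis k n (a + b, I ∪ J) := by
  obtain ⟨c, hc, h⟩ := exists_extBasis_mul (k := k) I J
  refine ⟨c, hc, ?_⟩
  rw [← polyIncl_mul_rBasis, rBasis_apply a, rBasis_apply b, rBasis_apply b, mul_assoc,
    ← mul_assoc (extIncl k n _) (polyIncl k n _), polyIncl_central, mul_assoc (polyIncl k n _)
    (extIncl k n _), ← map_mul, h, map_smul, mul_smul_comm, mul_smul_comm]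

theorem exists_monom_eq (a : Fin n →₀ ℕ) (l : List (Fin n)) :
    ∃ c : k, (c ≠ 0 ↔ l.Nodup) ∧ monom k a l = c • rBasis k n (a, l.toFinset) := by
  obtain ⟨c, hc, h⟩ := exists_prod_ι_eq (k := k) l
  refine ⟨c, hc, ?_⟩
  have : (l.map (ξ k)).prod = extIncl k n (l.map fun i => ExteriorAlgebra.ι k (Pi.single i (1 : k))).prod := by
    rw [map_list_prod, List.map_map]
    rfl
  rw [monom, this, h, rBasis_apply, map_smul, mul_smul_comm]

end RBasis

section Degrees

variable (p : ℕ) (k : Type u) [Field k] {n : ℕ}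

/-- The degree of the basis element `x^a ξ_I` of `R`. -/
def tdeg (t : (Fin n →₀ ℕ) × Finset (Fin n)) : ZInv p :=
  ∑ i, (t.1 i : ZInv p) * degX p i + ∑ i ∈ t.2, degΞ p i

theorem degMonom_eq_tdeg (a : Fin n →₀ ℕ) {l : List (Fin n)} (hl : l.Nodup) :
    degMonom p a l = tdeg p (a, l.toFinset) := by
  rw [degMonom, tdeg, List.sum_toFinset _ hl, Finsupp.sum_fintype _ _ (by simp)]

theorem piece_eq_span (d : ZInv p) :
    piece p k n d = Submodule.span k (rBasis k n '' {t | tdeg p t = d}) := by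
  apply le_antisymm
  · rw [piece, Submodule.span_le]
    rintro _ ⟨a, l, rfl, rfl⟩
    obtain ⟨c, hc, h⟩ := exists_monom_eq (k := k) a l
    rw [h]
    by_cases hl : l.Nodup
    · exact Submodule.smul_mem _ _ (Submodule.subset_span ⟨_, (degMonom_eq_tdeg p a hl).symm, rfl⟩)
    · have : c = 0 := by
        by_contra h0
        exact hl (hc.1 h0)
      rw [this, zero_smul]
      exact zero_mem _
  · rw [Submodule.span_le]
    rintro _ ⟨⟨a, I⟩, rfl, rfl⟩
    obtain ⟨c, hc, h⟩ := exists_monom_eq (k := k) a I.toList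
    have hc0 := hc.2 I.nodup_toList
    rw [Finset.toList_toFinset] at h
    have h' : rBasis k n (a, I) = c⁻¹ • monom k a I.toList := by
      rw [h, smul_smul, inv_mul_cancel₀ hc0, one_smul]
    rw [h']
    refine Submodule.smul_mem _ _ (Submodule.subset_span ⟨a, I.toList, ?_, rfl⟩)
    rw [degMonom_eq_tdeg p a I.nodup_toList, Finset.toList_toFinset]

/-- The pairs `(a, I)` for which `x^a ξ_I` has integer degree. -/
def IsInt (t : (Fin n →₀ ℕ) × Finset (Fin n)) : Prop := ∃ m : ℤ, tdeg p t = m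

theorem toSubmodule_E :
    Subalgebra.toSubmodule (E p k n) =
      Submodule.span k (Set.range fun t : {t : (Fin n →₀ ℕ) × Finset (Fin n) // IsInt p t} =>
        rBasis k n t) := by
  have h1 : Subalgebra.toSubmodule (E p k n) = ⨆ m : ℤ, piece p k n (m : ZInv p) := rfl
  rw [h1]
  simp only [piece_eq_span]
  rw [← Submodule.span_iUnion, ← Set.image_iUnion]
  congr 1
  ext z
  simp [IsInt]

variable (n) in
/-- The basis of `ℰₙ(p)` formed by the monomials `x^a ξ_I` of integer degree. -/
def eBasis : Module.Basis {t : (Fin n →₀ ℕ) × Finset (Fin n) // IsInt p t} k (E p k n) :=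
  (Module.Basis.span ((rBasis k n).linearIndependent.comp _ Subtype.val_injective)).map
    (LinearEquiv.ofEq _ _ (toSubmodule_E p k).symm)

theorem coe_eBasis (t : {t : (Fin n →₀ ℕ) × Finset (Fin n) // IsInt p t}) :
    (eBasis p k n t : R k n) = rBasis k n t := by
  have h := Module.Basis.span_apply (M := R k n)
    ((rBasis k n).linearIndependent.comp (Subtype.val : {t // IsInt p t} → _)
      Subtype.val_injective) t
  exact congrArg Subtype.val h

theorem EPiece_eq_span (m : ℤ) :
    EPiece p k n m = Submodule.span k (eBasis p k n '' {t | tdeg p t.1 = m}) := by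
  have hinj : Function.Injective (E p k n).val.toLinearMap := Subtype.val_injective
  rw [← Submodule.comap_map_eq_of_injective hinj (Submodule.span k _), Submodule.map_span]
  have : (E p k n).val.toLinearMap '' (eBasis p k n '' {t | tdeg p t.1 = m}) =
      rBasis k n '' {t | tdeg p t = m} := by
    ext z
    constructor
    · rintro ⟨_, ⟨t, ht, rfl⟩, rfl⟩
      exact ⟨t, ht, (coe_eBasis p k t).symm⟩
    · rintro ⟨t, ht, rfl⟩
      exact ⟨_, ⟨⟨t, m, ht⟩, ht, rfl⟩, coe_eBasis p k _⟩
  rw [this, ← piece_eq_span]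
  rfl

end Degrees

/-! ### Arithmetic of the degrees -/

section Arithmetic

variable (p : ℕ) {n : ℕ}

/-- The degree `2 (p^j - 1)` of `y_j = x_j^(p^j)`, where `j = i + 1`. -/
def wt (i : Fin n) : ℕ := 2 * (p ^ (i.val + 1) - 1)

/-- The exponents of the monomial `y^m` in the variables `x`. -/
def pscale (m : Fin n →₀ ℕ) : Fin n →₀ ℕ :=
  Finsupp.equivFunOnFinite.symm fun i => p ^ (i.val + 1) * m i

theorem pscale_apply (m : Fin n →₀ ℕ) (i : Fin n) : pscale p m i = p ^ (i.val + 1) * m i := rfl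

theorem coe_tdeg (t : (Fin n →₀ ℕ) × Finset (Fin n)) :
    (tdeg p t : ℚ) = ∑ i, (t.1 i : ℚ) * (degX p i : ℚ) + ∑ i ∈ t.2, (degΞ p i : ℚ) := by
  simp [tdeg]

theorem natCast_zInv_injective : Function.Injective (Nat.cast : ℕ → ZInv p) := by
  intro a b h
  have := congrArg Subtype.val h
  simpa using this

theorem intCast_zInv_injective : Function.Injective (Int.cast : ℤ → ZInv p) := by
  intro a b h
  have := congrArg Subtype.val h
  simpa using this

/-- The exponents of the monomial complementary to `x^a ξ_I`. -/
def complIndex (t : (Fin n →₀ ℕ) × Finset (Fin n)) : (Fin n →₀ ℕ) × Finset (Fin n) :=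
  (Finsupp.equivFunOnFinite.symm fun i => p ^ (i.val + 1) - 1 - t.1 i, t.2ᶜ)

theorem complIndex_complIndex {t : (Fin n →₀ ℕ) × Finset (Fin n)} (ht : ∀ i, t.1 i < p ^ (i.val + 1)) :
    complIndex p (complIndex p t) = t := by
  refine Prod.ext (Finsupp.ext fun i => ?_) (compl_compl t.2)
  have := ht i
  change p ^ (i.val + 1) - 1 - (p ^ (i.val + 1) - 1 - t.1 i) = t.1 i
  omega

variable [hpp : Fact p.Prime]

theorem pInv_pow_mul (j : ℕ) : (p : ZInv p) ^ j * pInv p ^ j = 1 := by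
  rw [← mul_pow]
  have : (p : ZInv p) * pInv p = 1 := by
    apply Subtype.ext
    simp [pInv, hpp.out.ne_zero]
  rw [this, one_pow]

/-- The element `y_j = x_j^(p^j)` has integer degree. -/
theorem pow_mul_degX (i : Fin n) : (p : ZInv p) ^ (i.val + 1) * degX p i = (wt p i : ZInv p) := by
  have h1 : 1 ≤ p ^ (i.val + 1) := Nat.one_le_pow _ _ hpp.out.pos
  rw [wt, degX, mul_comm, mul_assoc, mul_comm (pInv p ^ _), pInv_pow_mul, mul_one]
  push_cast [h1]
  ring

theorem tdeg_pscale_add (m a : Fin n →₀ ℕ) (I : Finset (Fin n)) :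
    tdeg p (pscale p m + a, I) = ((∑ i, m i * wt p i : ℕ) : ZInv p) + tdeg p (a, I) := by
  have : ∀ i : Fin n, (((pscale p m + a) i : ℕ) : ZInv p) * degX p i =
      (m i : ZInv p) * (wt p i : ZInv p) + (a i : ZInv p) * degX p i := by
    intro i
    rw [← pow_mul_degX, Finsupp.add_apply, pscale_apply]
    push_cast
    ring
  simp only [tdeg, this, Finset.sum_add_distrib]
  push_cast
  ring

theorem coe_degX (i : Fin n) : (degX p i : ℚ) = 2 - 2 / (p : ℚ) ^ (i.val + 1) := by
  have hp0 : (p : ℚ) ≠ 0 := Nat.cast_ne_zero.2 hpp.out.ne_zero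
  have h2 : ((2 : ZInv p) : ℚ) = 2 := rfl
  simp only [degX, pInv, Subring.coe_mul, Subring.coe_pow, AddSubgroupClass.coe_sub,
    Subring.coe_one, Subring.coe_natCast, inv_pow, h2]
  field_simp

theorem coe_degΞ (i : Fin n) : (degΞ p i : ℚ) = 1 - 2 / (p : ℚ) ^ (i.val + 1) := by
  rw [degΞ, AddSubgroupClass.coe_sub, coe_degX, Subring.coe_one]
  ring

/-- Here `p ≠ 2` matters: for `p = 2` the element `ξ_1` would have degree zero. -/
theorem degΞ_pos (hp : Odd p) (i : Fin n) : 0 < (degΞ p i : ℚ) := by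
  have h3 : (3 : ℕ) ≤ p := by
    have := hpp.out.two_le
    obtain ⟨r, hr⟩ := hp
    omega
  have h3' : (3 : ℚ) ≤ p := by exact_mod_cast h3
  have h4 : (p : ℚ) ≤ (p : ℚ) ^ (i.val + 1) := le_self_pow₀ (by linarith) (by omega)
  rw [coe_degΞ, sub_pos, div_lt_one (by linarith)]
  linarith

theorem degX_pos (hp : Odd p) (i : Fin n) : 0 < (degX p i : ℚ) := by
  have := degΞ_pos p hp i
  rw [degΞ, AddSubgroupClass.coe_sub, Subring.coe_one] at this
  linarith

theorem tdeg_nonneg (hp : Odd p) (t : (Fin n →₀ ℕ) × Finset (Fin n)) : 0 ≤ (tdeg p t : ℚ) := by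
  rw [coe_tdeg]
  exact add_nonneg
    (Finset.sum_nonneg fun i _ => mul_nonneg (Nat.cast_nonneg _) (degX_pos p hp i).le)
    (Finset.sum_nonneg fun i _ => (degΞ_pos p hp i).le)

theorem eq_zero_of_tdeg_eq_zero (hp : Odd p) {t : (Fin n →₀ ℕ) × Finset (Fin n)}
    (h : tdeg p t = 0) : t = (0, ∅) := by
  have h1 : ∀ i ∈ Finset.univ, 0 ≤ (t.1 i : ℚ) * (degX p i : ℚ) :=
    fun i _ => mul_nonneg (Nat.cast_nonneg _) (degX_pos p hp i).le
  have h2 : ∀ i ∈ t.2, 0 ≤ (degΞ p i : ℚ) := fun i _ => (degΞ_pos p hp i).le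
  have h0 := coe_tdeg p t
  rw [h, Subring.coe_zero, eq_comm, add_eq_zero_iff_of_nonneg (Finset.sum_nonneg h1)
    (Finset.sum_nonneg h2), Finset.sum_eq_zero_iff_of_nonneg h1,
    Finset.sum_eq_zero_iff_of_nonneg h2] at h0
  refine Prod.ext (Finsupp.ext fun i => ?_) (Finset.eq_empty_of_forall_notMem fun i hi => ?_)
  · have := h0.1 i (Finset.mem_univ i)
    simpa [(degX_pos p hp i).ne'] using this
  · exact (degΞ_pos p hp i).ne' (h0.2 i hi)

theorem exists_nat_tdeg_eq (hp : Odd p) {t : (Fin n →₀ ℕ) × Finset (Fin n)} (h : IsInt p t) :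
    ∃ d : ℕ, tdeg p t = d := by
  obtain ⟨m, hm⟩ := h
  have h0 := tdeg_nonneg p hp t
  rw [hm] at h0
  have h1 : 0 ≤ m := by
    simp only [Subring.coe_intCast] at h0
    exact_mod_cast h0
  exact ⟨m.toNat, by rw [hm, ← Int.cast_natCast, Int.toNat_of_nonneg h1]⟩

variable (n) in
/-- The index set of the basis of `ℰₙ(p)` over `k[y₁, …, yₙ]`: the monomials `x^a ξ_I` of integer
degree with `a_i < p^i`, where `i` counts from one (`i.val + 1` for `i : Fin n`). -/
def BoxIndex : Type :=
  {t : (Fin n →₀ ℕ) × Finset (Fin n) // IsInt p t ∧ ∀ i, t.1 i < p ^ (i.val + 1)}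

instance : Finite (BoxIndex p n) := by
  have h1 : {m : Fin n →₀ ℕ | ∀ i, m i < p ^ (i.val + 1)}.Finite :=
    (Set.finite_Iic (Finsupp.equivFunOnFinite.symm fun i : Fin n => p ^ (i.val + 1))).subset
      fun m hm i => (hm i).le
  exact ((h1.prod (Set.finite_univ (α := Finset (Fin n)))).subset
    fun t (ht : IsInt p t ∧ ∀ i, t.1 i < p ^ (i.val + 1)) => ⟨ht.2, trivial⟩).to_subtype

instance : Fintype (BoxIndex p n) := Fintype.ofFinite _

instance : DecidableEq (BoxIndex p n) := Classical.decEq _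

theorem isInt_pscale_add_iff (m a : Fin n →₀ ℕ) (I : Finset (Fin n)) :
    IsInt p (pscale p m + a, I) ↔ IsInt p (a, I) := by
  rw [IsInt, IsInt, tdeg_pscale_add]
  constructor
  · rintro ⟨d, hd⟩
    exact ⟨d - (∑ i, m i * wt p i : ℕ), by
      rw [Int.cast_sub, Int.cast_natCast, ← hd]; ring⟩
  · rintro ⟨d, hd⟩
    exact ⟨(∑ i, m i * wt p i : ℕ) + d, by
      rw [Int.cast_add, Int.cast_natCast, hd]⟩

/-- Division with remainder: `(m, (a, I)) ↦ y^m x^a ξ_I` is a bijection onto the monomials of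
integer degree. -/
def splitEquiv : (Fin n →₀ ℕ) × BoxIndex p n ≃
    {t : (Fin n →₀ ℕ) × Finset (Fin n) // IsInt p t} :=
  have hpos : ∀ i : Fin n, 0 < p ^ (i.val + 1) := fun _ => pow_pos hpp.out.pos _
  have hdm : ∀ b : Fin n →₀ ℕ,
      pscale p (Finsupp.equivFunOnFinite.symm fun i : Fin n => b i / p ^ (i.val + 1)) +
        (Finsupp.equivFunOnFinite.symm fun i : Fin n => b i % p ^ (i.val + 1)) = b :=
    fun b => Finsupp.ext fun i => Nat.div_add_mod (b i) (p ^ (i.val + 1))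
  { toFun := fun t => ⟨(pscale p t.1 + t.2.1.1, t.2.1.2), (isInt_pscale_add_iff p _ _ _).2 t.2.2.1⟩
    invFun := fun t => (Finsupp.equivFunOnFinite.symm fun i => t.1.1 i / p ^ (i.val + 1),
      ⟨(Finsupp.equivFunOnFinite.symm fun i => t.1.1 i % p ^ (i.val + 1), t.1.2),
        (isInt_pscale_add_iff p _ _ _).1 (by rw [hdm]; exact t.2),
        fun i => Nat.mod_lt _ (hpos i)⟩)
    left_inv := by
      rintro ⟨m, ⟨⟨a, I⟩, h1, h2⟩⟩
      refine Prod.ext (Finsupp.ext fun i => ?_) (Subtype.ext (Prod.ext (Finsupp.ext fun i => ?_) rfl))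
      · change (p ^ (i.val + 1) * m i + a i) / p ^ (i.val + 1) = m i
        rw [Nat.mul_add_div (hpos i), Nat.div_eq_of_lt (h2 i), add_zero]
      · change (p ^ (i.val + 1) * m i + a i) % p ^ (i.val + 1) = a i
        rw [Nat.mul_add_mod, Nat.mod_eq_of_lt (h2 i)]
    right_inv := fun t => Subtype.ext (Prod.ext (hdm t.1.1) rfl) }

/-- The product of a monomial with the complementary one has exponents `p^j - 1` in `x_j`, and contains
all the `ξ_j`; its degree is `∑ (deg y_j - deg x_j) + ∑ (deg x_j - 1)`. -/
theorem tdeg_complIndex_add {t : (Fin n →₀ ℕ) × Finset (Fin n)} (ht : ∀ i, t.1 i < p ^ (i.val + 1)) :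
    tdeg p (complIndex p t) + tdeg p t + n = ((∑ i : Fin n, wt p i : ℕ) : ZInv p) := by
  have h1 : ∀ i : Fin n, (((complIndex p t).1 i : ℕ) : ZInv p) * degX p i + (t.1 i : ZInv p) * degX p i =
      (wt p i : ZInv p) - degX p i := by
    intro i
    have h : (complIndex p t).1 i + t.1 i + 1 = p ^ (i.val + 1) := by
      have := ht i
      change p ^ (i.val + 1) - 1 - t.1 i + t.1 i + 1 = _
      omega
    have h' : (((complIndex p t).1 i : ℕ) : ZInv p) + (t.1 i : ZInv p) + 1 = (p : ZInv p) ^ (i.val + 1) := by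
      exact_mod_cast congrArg (Nat.cast : ℕ → ZInv p) h
    rw [← pow_mul_degX, ← h']
    ring
  have h2 : ∑ i ∈ t.2ᶜ, degΞ p i + ∑ i ∈ t.2, degΞ p i = ∑ i : Fin n, (degX p i - 1) :=
    Finset.sum_compl_add_sum _ _
  have h3 : tdeg p (complIndex p t) + tdeg p t =
      ∑ i, ((((complIndex p t).1 i : ℕ) : ZInv p) * degX p i + (t.1 i : ZInv p) * degX p i) +
      (∑ i ∈ t.2ᶜ, degΞ p i + ∑ i ∈ t.2, degΞ p i) := by
    rw [Finset.sum_add_distrib, tdeg, tdeg]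
    change _ + ∑ i ∈ t.2ᶜ, degΞ p i + _ = _
    ring
  rw [h3, h2, Finset.sum_congr rfl fun i _ => h1 i, Finset.sum_sub_distrib, Finset.sum_sub_distrib]
  push_cast
  simp

variable (n) in
/-- The involution of the index set which takes a monomial to the complementary one. -/
def complEquiv : Equiv.Perm (BoxIndex p n) :=
  Function.Involutive.toPerm
    (fun j => ⟨complIndex p j.1, by
      obtain ⟨d, hd⟩ := j.2.1
      refine ⟨⟨(∑ i : Fin n, wt p i : ℕ) - n - d, ?_⟩, fun i => ?_⟩
      · rw [Int.cast_sub, Int.cast_sub, Int.cast_natCast, Int.cast_natCast, ← hd,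
          ← tdeg_complIndex_add p j.2.2]
        ring
      · have : 0 < p ^ (i.val + 1) := pow_pos hpp.out.pos _
        change p ^ (i.val + 1) - 1 - j.1.1 i < _
        omega⟩)
    (fun j => Subtype.ext (complIndex_complIndex p j.2.2))

variable (n) in
/-- The index of the monomial `1`. -/
def boxZero : BoxIndex p n :=
  ⟨(0, ∅), ⟨0, by simp [tdeg]⟩, fun _ => pow_pos hpp.out.pos _⟩

/-- The degree of the monomial with a given index. -/
def boxDeg (hp : Odd p) (j : BoxIndex p n) : ℕ := (exists_nat_tdeg_eq p hp j.2.1).choose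

theorem tdeg_eq_boxDeg (hp : Odd p) (j : BoxIndex p n) : tdeg p j.1 = boxDeg p hp j :=
  (exists_nat_tdeg_eq p hp j.2.1).choose_spec

theorem boxDeg_complEquiv_add (hp : Odd p) (j : BoxIndex p n) :
    boxDeg p hp (complEquiv p n j) + boxDeg p hp j + n = ∑ i : Fin n, wt p i := by
  apply natCast_zInv_injective p
  rw [← tdeg_complIndex_add p j.2.2, Nat.cast_add, Nat.cast_add, ← tdeg_eq_boxDeg, ← tdeg_eq_boxDeg]
  rfl

theorem boxDeg_boxZero (hp : Odd p) : boxDeg p hp (boxZero p n) = 0 := by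
  apply natCast_zInv_injective p
  rw [← tdeg_eq_boxDeg]
  simp [boxZero, tdeg]

/-- The monomial `1` is the only one of degree zero, so its complement `α` is the only basis element of
top degree. -/
theorem boxDeg_eq_top_iff (hp : Odd p) (j : BoxIndex p n) :
    boxDeg p hp j = boxDeg p hp (complEquiv p n (boxZero p n)) ↔ j = complEquiv p n (boxZero p n) := by
  refine ⟨fun h => ?_, fun h => by rw [h]⟩
  have h1 := boxDeg_complEquiv_add p hp j
  have h2 := boxDeg_complEquiv_add p hp (boxZero p n)
  rw [boxDeg_boxZero] at h2
  have h3 : boxDeg p hp (complEquiv p n j) = 0 := by omega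
  have h4 : complEquiv p n j = boxZero p n := by
    refine Subtype.ext (eq_zero_of_tdeg_eq_zero p hp ?_)
    rw [tdeg_eq_boxDeg p hp, h3, Nat.cast_zero]
  rw [← h4]
  exact (Subtype.ext (complIndex_complIndex p j.2.2)).symm

/-- The quotient on the right is exact, as `p - 1` divides `p^(n+1) - 1`. -/
theorem boxDeg_top (hp : Odd p) : ((boxDeg p hp (complEquiv p n (boxZero p n)) : ℕ) : ℤ) =
    2 * (((p : ℤ) ^ (n + 1) - 1) / ((p : ℤ) - 1)) - 3 * (n : ℤ) - 2 := by
  have h2 := boxDeg_complEquiv_add p hp (boxZero p n)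
  rw [boxDeg_boxZero, add_zero] at h2
  have hp1 : (p : ℤ) - 1 ≠ 0 := by
    have : (2 : ℤ) ≤ p := by exact_mod_cast hpp.out.two_le
    omega
  have hg : ((p : ℤ) ^ (n + 1) - 1) / ((p : ℤ) - 1) = ∑ i ∈ Finset.range (n + 1), (p : ℤ) ^ i :=
    Int.ediv_eq_of_eq_mul_left hp1 (geom_sum_mul _ _).symm
  have hw : ((∑ i : Fin n, wt p i : ℕ) : ℤ) = 2 * (∑ i ∈ Finset.range n, (p : ℤ) ^ (i + 1)) - 2 * n := by
    rw [Finset.sum_range, Finset.mul_sum]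
    have (i : Fin n) : (wt p i : ℤ) = 2 * (p : ℤ) ^ (i.val + 1) - 2 := by
      have h1 : 1 ≤ p ^ (i.val + 1) := Nat.one_le_pow _ _ hpp.out.pos
      rw [wt]
      push_cast [h1]
      ring
    push_cast
    simp [this, Finset.sum_sub_distrib, mul_comm]
  rw [hg, Finset.sum_range_succ', pow_zero]
  have h3 : ((boxDeg p hp (complEquiv p n (boxZero p n)) : ℕ) : ℤ) + n =
      ((∑ i : Fin n, wt p i : ℕ) : ℤ) := by exact_mod_cast h2
  linarith

/-! ### The number of basis elements -/

section Counting

theorem existsUnique_lt_dvd_add (M C : ℕ) (hM : 0 < M) : ∃! r, r < M ∧ M ∣ C + r := by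
  have h1 := Nat.mod_lt C hM
  have h2 := Nat.div_add_mod C M
  by_cases h0 : C % M = 0
  · refine ⟨0, ⟨hM, by simpa using Nat.dvd_of_mod_eq_zero h0⟩, ?_⟩
    rintro r ⟨hr, hd⟩
    have := (Nat.dvd_add_right (Nat.dvd_of_mod_eq_zero h0)).1 hd
    exact Nat.eq_zero_of_dvd_of_lt this hr
  · refine ⟨M - C % M, ⟨by omega, ⟨C / M + 1, ?_⟩⟩, ?_⟩
    · rw [mul_add, mul_one]
      omega
    · rintro r ⟨hr, hd⟩
      have h3 : M ∣ C % M + r := by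
        rw [← h2, add_assoc] at hd
        exact (Nat.dvd_add_right (Nat.dvd_mul_right _ _)).1 hd
      obtain ⟨q, hq⟩ := h3
      have hq1 : q = 1 := by
        have : M * q < M * 2 := by omega
        have hlt := Nat.lt_of_mul_lt_mul_left this
        have : q ≠ 0 := by
          rintro rfl
          omega
        omega
      rw [hq1, mul_one] at hq
      omega

/-- Among the exponents `a_i < p^i`, the last one is determined by the others, since it occurs
in the congruence with coefficient one. -/
theorem card_congruence (n : ℕ) (e : Fin n → ℕ) :
    Nat.card {a : (i : Fin n) → Fin (p ^ (i.val + 1)) //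
      p ^ n ∣ ∑ i, ((a i : ℕ) + e i) * p ^ (n - 1 - i.val)} = p ^ (n * (n - 1) / 2) := by
  cases n with
  | zero => simp
  | succ m =>
    let f : {a : (i : Fin (m + 1)) → Fin (p ^ (i.val + 1)) //
        p ^ (m + 1) ∣ ∑ i, ((a i : ℕ) + e i) * p ^ (m + 1 - 1 - i.val)} →
        ((i : Fin m) → Fin (p ^ (i.val + 1))) := fun a i => a.1 i.castSucc
    have hf : Function.Bijective f := by
      rw [Function.bijective_iff_existsUnique]
      intro b
      obtain ⟨r, ⟨hr, hd⟩, hu⟩ := existsUnique_lt_dvd_add (p ^ (m + 1))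
        (∑ i : Fin m, ((b i : ℕ) + e i.castSucc) * p ^ (m - i.val) + e (Fin.last m))
        (pow_pos hpp.out.pos _)
      have hsum (a : (i : Fin (m + 1)) → Fin (p ^ (i.val + 1))) (ha : ∀ i : Fin m, a i.castSucc = b i) :
          ∑ i, ((a i : ℕ) + e i) * p ^ (m + 1 - 1 - i.val) =
          ∑ i : Fin m, ((b i : ℕ) + e i.castSucc) * p ^ (m - i.val) + e (Fin.last m) +
            a (Fin.last m) := by
        rw [Fin.sum_univ_castSucc]
        simp only [ha, Fin.val_castSucc, Fin.val_last, Nat.add_sub_cancel, Nat.sub_self, pow_zero,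
          mul_one]
        ring
      let a₀ : (i : Fin (m + 1)) → Fin (p ^ (i.val + 1)) :=
        Fin.snoc (α := fun i : Fin (m + 1) => Fin (p ^ (i.val + 1))) b ⟨r, hr⟩
      have ha₀ (i : Fin m) : a₀ i.castSucc = b i := Fin.snoc_castSucc ..
      have ha₀' : (a₀ (Fin.last m) : ℕ) = r := by
        have : a₀ (Fin.last m) = ⟨r, hr⟩ := Fin.snoc_last ..
        rw [this]
      refine ⟨⟨a₀, ?_⟩, funext ha₀, ?_⟩
      · rw [hsum a₀ ha₀, ha₀']
        exact hd
      · rintro ⟨a, ha⟩ hab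
        have hab' (i : Fin m) : a i.castSucc = b i := congrFun hab i
        rw [hsum a hab'] at ha
        have hlast := hu _ ⟨(a (Fin.last m)).2, ha⟩
        refine Subtype.ext (funext fun i => ?_)
        refine Fin.lastCases ?_ (fun i => ?_) i
        · exact Fin.ext (hlast.trans ha₀'.symm)
        · exact (hab' i).trans (ha₀ i).symm
    rw [Nat.card_congr (Equiv.ofBijective f hf), Nat.card_pi]
    simp only [Nat.card_eq_fintype_card, Fintype.card_fin]
    rw [Finset.prod_pow_eq_pow_sum, ← Finset.sum_range_id, Finset.sum_range_succ',
      Finset.sum_range, add_zero]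

/-- The degree of `x^a ξ_I` is an integer if and only if `∑ (a_i + e_i) / p^i` is, where `e` is the
characteristic function of `I`; the factor `2` is invertible modulo the odd prime `p`. -/
theorem isInt_iff_dvd (hp : Odd p) (a : Fin n →₀ ℕ) (I : Finset (Fin n)) :
    IsInt p (a, I) ↔
      p ^ n ∣ ∑ i, (a i + if i ∈ I then 1 else 0) * p ^ (n - 1 - i.val) := by
  set N := ∑ i, (a i + if i ∈ I then 1 else 0) * p ^ (n - 1 - i.val) with hN
  have hp0 : (p : ℚ) ≠ 0 := Nat.cast_ne_zero.2 hpp.out.ne_zero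
  have hpn : (p : ℚ) ^ n ≠ 0 := pow_ne_zero _ hp0
  have hterm (i : Fin n) : ((p : ℚ) ^ (i.val + 1))⁻¹ = (p : ℚ) ^ (n - 1 - i.val) / (p : ℚ) ^ n := by
    rw [eq_div_iff hpn, inv_mul_eq_iff_eq_mul₀ (pow_ne_zero _ hp0), ← pow_add]
    congr 1
    omega
  have hdeg : (tdeg p (a, I) : ℚ) =
      (2 * ∑ i, ((a i + if i ∈ I then 1 else 0 : ℕ) : ℤ) - I.card : ℤ) - 2 * (N : ℚ) / (p : ℚ) ^ n := by
    have h1 : ∑ i ∈ I, (degΞ p i : ℚ) = ∑ i, if i ∈ I then (degΞ p i : ℚ) else 0 := by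
      rw [Finset.sum_ite_mem, Finset.univ_inter]
    have h2 : ((I.card : ℤ) : ℚ) = ∑ i, if i ∈ I then (1 : ℚ) else 0 := by
      simp
    have h3 : (N : ℚ) / (p : ℚ) ^ n =
        ∑ i, ((a i : ℚ) + if i ∈ I then 1 else 0) * ((p : ℚ) ^ (i.val + 1))⁻¹ := by
      rw [hN]
      push_cast
      rw [Finset.sum_div]
      exact Finset.sum_congr rfl fun i _ => by rw [hterm, mul_div_assoc]
    rw [coe_tdeg, h1, mul_div_assoc, h3, Int.cast_sub, h2]
    push_cast
    rw [Finset.mul_sum, Finset.mul_sum, ← Finset.sum_add_distrib, ← Finset.sum_sub_distrib,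
      ← Finset.sum_sub_distrib]
    refine Finset.sum_congr rfl fun i _ => ?_
    rw [coe_degX, coe_degΞ, div_eq_mul_inv]
    split_ifs <;> ring
  have hcast (m : ℤ) : tdeg p (a, I) = m ↔ (tdeg p (a, I) : ℚ) = m := by
    rw [Subtype.ext_iff, Subring.coe_intCast]
  have hcop : Nat.Coprime (p ^ n) 2 := (Nat.coprime_two_right.2 hp).pow_left n
  rw [← hcop.dvd_mul_left]
  constructor
  · rintro ⟨m, hm⟩
    rw [hcast, hdeg] at hm
    have h4 : (2 * (N : ℚ)) = (p : ℚ) ^ n *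
        ((2 * ∑ i, ((a i + if i ∈ I then 1 else 0 : ℕ) : ℤ) - I.card - m : ℤ) : ℚ) := by
      rw [Int.cast_sub, ← hm]
      field_simp
      ring
    have h5 : ((p ^ n : ℕ) : ℤ) ∣ ((2 * N : ℕ) : ℤ) := ⟨_, by exact_mod_cast h4⟩
    exact Int.natCast_dvd_natCast.1 h5
  · rintro ⟨q, hq⟩
    refine ⟨(2 * ∑ i, ((a i + if i ∈ I then 1 else 0 : ℕ) : ℤ) - I.card : ℤ) - q, ?_⟩
    rw [hcast, hdeg, Int.cast_sub]
    have h6 : 2 * (N : ℚ) = (p : ℚ) ^ n * q := by exact_mod_cast hq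
    rw [h6, mul_div_cancel_left₀ _ hpn]
    push_cast
    ring

theorem card_boxIndex (hp : Odd p) :
    Fintype.card (BoxIndex p n) = 2 ^ n * p ^ (n * (n - 1) / 2) := by
  let S : Finset (Fin n) → Type := fun I => {a : (i : Fin n) → Fin (p ^ (i.val + 1)) //
      p ^ n ∣ ∑ i, ((a i : ℕ) + if i ∈ I then 1 else 0) * p ^ (n - 1 - i.val)}
  let F : BoxIndex p n ≃ Σ I : Finset (Fin n), S I :=
    { toFun := fun j => ⟨j.1.2, fun i => ⟨j.1.1 i, j.2.2 i⟩, (isInt_iff_dvd p hp j.1.1 j.1.2).1 j.2.1⟩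
      invFun := fun s => ⟨(Finsupp.equivFunOnFinite.symm fun i => (s.2.1 i : ℕ), s.1),
        (isInt_iff_dvd p hp _ s.1).2 s.2.2, fun i => (s.2.1 i).2⟩
      left_inv := fun j => Subtype.ext (Prod.ext (Finsupp.ext fun _ => rfl) rfl)
      right_inv := fun s => rfl }
  have hS (I : Finset (Fin n)) : Nat.card (S I) = p ^ (n * (n - 1) / 2) :=
    card_congruence p n fun i => if i ∈ I then 1 else 0
  rw [← Nat.card_eq_fintype_card, Nat.card_congr F, Nat.card_sigma,
    Finset.sum_congr rfl fun I _ => hS I]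
  simp

end Counting

end Arithmetic

/-! ### The basis over the ring of parameters -/

section PolynomialAction

open MvPolynomial

variable (p : ℕ) [hpp : Fact p.Prime] (k : Type u) [Field k] (n : ℕ)

instance : SetLike.GradedMonoid (EPiece p k n) where
  one_mem := by
    change (1 : R k n) ∈ piece p k n ((0 : ℤ) : ZInv p)
    rw [Int.cast_zero]
    exact SetLike.GradedOne.one_mem
  mul_mem := by
    intro i j a b ha hb
    change (a * b : R k n) ∈ piece p k n ((i + j : ℤ) : ZInv p)
    rw [Int.cast_add]
    exact SetLike.GradedMul.mul_mem ha hb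

theorem polyIncl_pscale_mem (m : Fin n →₀ ℕ) :
    polyIncl k n (monomial (pscale p m) 1) ∈ E p k n := by
  have h : IsInt p (pscale p m + 0, (∅ : Finset (Fin n))) :=
    (isInt_pscale_add_iff p m 0 ∅).2 (boxZero p n).2.1
  have h1 : polyIncl k n (monomial (pscale p m) 1) = eBasis p k n ⟨_, h⟩ := by
    have h2 : polyIncl k n (monomial 0 1) = 1 := map_one (polyIncl k n)
    rw [coe_eBasis, ← polyIncl_mul_rBasis, rBasis_apply, extBasis_empty, map_one (extIncl k n), h2,
      mul_one, mul_one]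
  rw [h1]
  exact (eBasis p k n ⟨_, h⟩).2

/-- The substitution `X_i ↦ x_i^(p^i)`, where `i` counts from one. -/
def powSubst : MvPolynomial (Fin n) k →ₐ[k] MvPolynomial (Fin n) k :=
  aeval fun i => X i ^ p ^ (i.val + 1)

omit hpp in
theorem powSubst_monomial (m : Fin n →₀ ℕ) :
    powSubst p k n (monomial m 1) = monomial (pscale p m) 1 := by
  rw [powSubst, aeval_monomial, map_one, one_mul, monomial_eq, map_one, one_mul,
    Finsupp.prod_fintype _ _ (by simp), Finsupp.prod_fintype _ _ (by simp)]
  simp only [← pow_mul, pscale_apply]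

/-- The homomorphism `k[y₁, …, yₙ] → ℰₙ(p)`. -/
def polyToE : MvPolynomial (Fin n) k →ₐ[k] E p k n :=
  ((polyIncl k n).comp (powSubst p k n)).codRestrict (E p k n) fun f => by
    induction f using MvPolynomial.induction_on' with
    | monomial m c =>
      have : monomial m c = c • monomial m (1 : k) := by rw [smul_monomial, smul_eq_mul, mul_one]
      rw [this, map_smul, AlgHom.comp_apply, powSubst_monomial]
      exact (E p k n).smul_mem (polyIncl_pscale_mem p k n m) c
    | add f g hf hg =>
      rw [map_add]
      exact add_mem hf hg

theorem coe_polyToE (f : MvPolynomial (Fin n) k) :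
    (polyToE p k n f : R k n) = polyIncl k n (powSubst p k n f) := rfl

/-- `ℰₙ(p)` as an algebra over a polynomial ring, whose variables act by the elements `y_i`. -/
instance : Algebra (MvPolynomial (Fin n) k) (E p k n) :=
  RingHom.toAlgebra' (polyToE p k n).toRingHom fun f z =>
    Subtype.ext (polyIncl_central k n (powSubst p k n f) z).symm

theorem algebraMap_E (f : MvPolynomial (Fin n) k) :
    algebraMap (MvPolynomial (Fin n) k) (E p k n) f = polyToE p k n f := rfl

instance : IsScalarTower k (MvPolynomial (Fin n) k) (E p k n) :=
  IsScalarTower.of_algebraMap_eq fun c => ((polyToE p k n).commutes c).symm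

theorem coe_param (i : Fin n) :
    ((param (k := k) (E p k n) i : E p k n) : R k n) = x k i ^ p ^ (i.val + 1) := by
  change polyIncl k n (powSubst p k n (X i)) = _
  rw [powSubst, aeval_X, map_pow, x]

theorem monomial_smul_eBasis (m : Fin n →₀ ℕ) (j : BoxIndex p n) :
    monomial m (1 : k) • eBasis p k n ⟨j.1, j.2.1⟩ = eBasis p k n (splitEquiv p (m, j)) := by
  apply Subtype.ext
  rw [coe_eBasis, Algebra.smul_def, algebraMap_E]
  change (polyToE p k n (monomial m 1) : R k n) * (eBasis p k n ⟨j.1, j.2.1⟩ : R k n) = _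
  rw [coe_polyToE, powSubst_monomial, coe_eBasis]
  exact polyIncl_mul_rBasis _ _ _

theorem exists_boxBasis : ∃ b : Module.Basis (BoxIndex p n) (MvPolynomial (Fin n) k) (E p k n),
    ∀ j, b j = eBasis p k n ⟨j.1, j.2.1⟩ :=
  exists_basis_of_monomial_smul (fun j : BoxIndex p n => eBasis p k n ⟨j.1, j.2.1⟩)
    ((eBasis p k n).reindex (splitEquiv p).symm) fun m j => by
      rw [monomial_smul_eBasis, Module.Basis.reindex_apply, Equiv.symm_symm]

/-- The basis of `ℰₙ(p)` over `k[y₁, …, yₙ]` formed by the monomials `x^a ξ_I` of integer degree with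
`a_i < p^i`. -/
def boxBasis : Module.Basis (BoxIndex p n) (MvPolynomial (Fin n) k) (E p k n) :=
  (exists_boxBasis p k n).choose

theorem boxBasis_apply (j : BoxIndex p n) :
    boxBasis p k n j = eBasis p k n ⟨j.1, j.2.1⟩ := (exists_boxBasis p k n).choose_spec j

theorem monomialBasis_boxBasis (t : (Fin n →₀ ℕ) × BoxIndex p n) :
    monomialBasis (boxBasis p k n) t = eBasis p k n (splitEquiv p t) := by
  rw [monomialBasis_apply, boxBasis_apply, monomial_smul_eBasis]

theorem EPiece_eq_span_monomialBasis (hp : Odd p) (d : ℤ) :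
    EPiece p k n d = Submodule.span k (monomialBasis (boxBasis p k n) ''
      {t | (wdeg (wt p) (boxDeg p hp) t : ℤ) = d}) := by
  have hdeg (t : (Fin n →₀ ℕ) × BoxIndex p n) :
      tdeg p (splitEquiv p t).1 = ((wdeg (wt p) (boxDeg p hp) t : ℤ) : ZInv p) := by
    rw [Int.cast_natCast, wdeg, Nat.cast_add, ← tdeg_eq_boxDeg]
    exact tdeg_pscale_add p _ _ _
  rw [EPiece_eq_span]
  congr 1
  ext z
  constructor
  · rintro ⟨t, ht, rfl⟩
    refine ⟨(splitEquiv p).symm t, intCast_zInv_injective p ?_, ?_⟩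
    · rw [← hdeg, Equiv.apply_symm_apply]
      exact ht
    · rw [monomialBasis_boxBasis, Equiv.apply_symm_apply]
  · rintro ⟨t, ht, rfl⟩
    refine ⟨splitEquiv p t, ?_, (monomialBasis_boxBasis p k n t).symm⟩
    change tdeg p _ = _
    rw [hdeg, ht]

/-- The index of the monomial `α` of top degree. -/
def boxTop : BoxIndex p n := complEquiv p n (boxZero p n)

omit hpp in
theorem tdeg_add_of_disjoint {a b : Fin n →₀ ℕ} {I J : Finset (Fin n)} (h : Disjoint I J) :
    tdeg p (a + b, I ∪ J) = tdeg p (a, I) + tdeg p (b, J) := by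
  simp only [tdeg, Finset.sum_union h, Finsupp.add_apply, Nat.cast_add, add_mul,
    Finset.sum_add_distrib]
  ring

theorem boxBasis_mul_eq_zero {i j : BoxIndex p n} (h : ¬Disjoint i.1.2 j.1.2) :
    boxBasis p k n i * boxBasis p k n j = 0 := by
  obtain ⟨c, hc, hm⟩ := exists_rBasis_mul (k := k) i.1.1 j.1.1 i.1.2 j.1.2
  have hc0 : c = 0 := by
    by_contra h0
    exact h (hc.1 h0)
  rw [hc0, zero_smul] at hm
  apply Subtype.ext
  rw [boxBasis_apply, boxBasis_apply]
  change (eBasis p k n _ : R k n) * (eBasis p k n _ : R k n) = 0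
  rw [coe_eBasis, coe_eBasis]
  exact hm

/-- If no exterior generator is repeated, the product of two basis elements is, up to a nonzero
constant, a monomial in the `y_i` times a basis element. -/
theorem exists_boxBasis_mul {i j : BoxIndex p n} (h : Disjoint i.1.2 j.1.2) :
    ∃ (c : kˣ) (m : Fin n →₀ ℕ) (l : BoxIndex p n),
      boxBasis p k n i * boxBasis p k n j = monomial m (c : k) • boxBasis p k n l ∧
      pscale p m + l.1.1 = i.1.1 + j.1.1 ∧ l.1.2 = i.1.2 ∪ j.1.2 := by
  obtain ⟨c, hc, hm⟩ := exists_rBasis_mul (k := k) i.1.1 j.1.1 i.1.2 j.1.2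
  have hint : IsInt p (i.1.1 + j.1.1, i.1.2 ∪ j.1.2) := by
    obtain ⟨d, hd⟩ := i.2.1
    obtain ⟨e, he⟩ := j.2.1
    exact ⟨d + e, by rw [tdeg_add_of_disjoint p n h, Int.cast_add, ← hd, ← he]⟩
  obtain ⟨⟨m, l⟩, hml⟩ := (splitEquiv p).surjective ⟨_, hint⟩
  have hml' := congrArg Subtype.val hml
  refine ⟨Units.mk0 c (hc.2 h), m, l, ?_, congrArg Prod.fst hml', congrArg Prod.snd hml'⟩
  have hmc : monomial m (Units.mk0 c (hc.2 h) : k) = c • monomial m (1 : k) := by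
    rw [smul_monomial, smul_eq_mul, mul_one, Units.val_mk0]
  rw [hmc, smul_assoc, boxBasis_apply, boxBasis_apply, boxBasis_apply, monomial_smul_eBasis, hml]
  apply Subtype.ext
  change (eBasis p k n _ : R k n) * (eBasis p k n _ : R k n) = c • (eBasis p k n _ : R k n)
  rw [coe_eBasis, coe_eBasis, coe_eBasis]
  exact hm

/-- The monomial `α` occurs in the product of two basis elements only if these are complementary:
the exponents `a_i, b_i < p^i` satisfy `a_i + b_i < p^i + (p^i - 1)`, so no factor `y_i` splits off. -/
theorem boxBasis_gram : ∃ c : BoxIndex p n → kˣ, ∀ i j,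
    (boxBasis p k n).repr (boxBasis p k n i * boxBasis p k n j) (boxTop p n) =
      if j = complEquiv p n i then C (c i : k) else 0 := by
  have hdisj (i : BoxIndex p n) : Disjoint i.1.2 (complEquiv p n i).1.2 := disjoint_compl_right
  choose c hc using fun i => exists_boxBasis_mul p k n (hdisj i)
  refine ⟨c, fun i j => ?_⟩
  split_ifs with hj
  · obtain ⟨m, l, h, h1, h2⟩ := hc i
    have h3 (r : Fin n) : p ^ (r.val + 1) * m r + l.1.1 r = p ^ (r.val + 1) - 1 := by
      have := DFunLike.congr_fun h1 r
      have hi := i.2.2 r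
      change p ^ (r.val + 1) * m r + l.1.1 r = i.1.1 r + (p ^ (r.val + 1) - 1 - i.1.1 r) at this
      omega
    have hm (r : Fin n) : m r = 0 := by
      have := h3 r
      have hpos : 0 < p ^ (r.val + 1) := pow_pos hpp.out.pos _
      by_contra h0
      have := Nat.le_mul_of_pos_right (p ^ (r.val + 1)) (Nat.pos_of_ne_zero h0)
      omega
    have hl : l = boxTop p n := by
      refine Subtype.ext (Prod.ext (Finsupp.ext fun r => ?_) ?_)
      · have := h3 r
        rw [hm, mul_zero, zero_add] at this
        exact this
      · rw [h2]
        change i.1.2 ∪ i.1.2ᶜ = ∅ᶜ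
        rw [Finset.union_compl, Finset.compl_empty]
    have hm0 : m = 0 := Finsupp.ext hm
    rw [hj, h, hl, hm0, map_smul, Module.Basis.repr_self, Finsupp.smul_single,
      Finsupp.single_eq_same, smul_eq_mul, mul_one]
    rfl
  · by_cases hd : Disjoint i.1.2 j.1.2
    · obtain ⟨c, m, l, h, h1, h2⟩ := exists_boxBasis_mul p k n hd
      rw [h, map_smul, Module.Basis.repr_self, Finsupp.smul_single, Finsupp.single_apply,
        if_neg]
      rintro rfl
      refine hj (Subtype.ext (Prod.ext (Finsupp.ext fun r => ?_) ?_))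
      · have := DFunLike.congr_fun h1 r
        have hi := i.2.2 r
        have hjr := j.2.2 r
        change p ^ (r.val + 1) * m r + (p ^ (r.val + 1) - 1 - 0) = i.1.1 r + j.1.1 r at this
        change j.1.1 r = p ^ (r.val + 1) - 1 - i.1.1 r
        have hm : m r = 0 := by
          by_contra h0
          have := Nat.le_mul_of_pos_right (p ^ (r.val + 1)) (Nat.pos_of_ne_zero h0)
          omega
        rw [hm] at this
        omega
      · change (∅ : Finset (Fin n))ᶜ = _ at h2
        rw [Finset.compl_empty] at h2
        exact (IsCompl.of_eq (disjoint_iff.1 hd) h2.symm).compl_eq.symm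
    · rw [boxBasis_mul_eq_zero p k n hd, map_zero, Finsupp.zero_apply]

end PolynomialAction

/-! ### Consequences for the algebra -/

section Conclusions

open MvPolynomial

variable (p : ℕ) [hpp : Fact p.Prime] (k : Type u) [Field k] (n : ℕ)

variable {n} in
theorem wt_pos (i : Fin n) : 0 < wt p i := by
  have : 1 < p ^ (i.val + 1) := Nat.one_lt_pow (Nat.succ_ne_zero i.val) hpp.out.one_lt
  rw [wt]
  omega

variable {n} in
theorem cast_wt (i : Fin n) : (wt p i : ℤ) = 2 * ((p : ℤ) ^ (i.val + 1) - 1) := by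
  have h1 : 1 ≤ p ^ (i.val + 1) := Nat.one_le_pow _ _ hpp.out.pos
  rw [wt]
  push_cast [h1]
  ring

theorem isGorenstein_E : IsGorenstein (E p k n) := by
  obtain ⟨c, hc⟩ := boxBasis_gram p k n
  refine isGorenstein_of_gram (boxBasis p k n) ((boxBasis p k n).coord (boxTop p n))
    (complEquiv p n) (fun j => Subtype.ext (complIndex_complIndex p j.2.2))
    (fun i => Units.map (C : k →+* MvPolynomial (Fin n) k).toMonoidHom (c i)) hc n ?_
  exact hasInjectiveDimensionLE_of_forall_hasProjectiveDimensionLE n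
    (hasProjectiveDimensionLE_mvPolynomial k n) _

theorem gradedAlgebra_EPiece (hp : Odd p) : Nonempty (GradedAlgebra (EPiece p k n)) :=
  gradedAlgebra_of_isInternal _ (isInternal_of_basis (monomialBasis (boxBasis p k n))
    (fun t => (wdeg (wt p) (boxDeg p hp) t : ℤ)) (EPiece_eq_span_monomialBasis p k n hp))

theorem param_mem_EPiece (i : Fin n) :
    (param (k := k) (E p k n) i : E p k n) ∈ EPiece p k n (2 * ((p : ℤ) ^ (i.val + 1) - 1)) := by
  change ((param (k := k) (E p k n) i : E p k n) : R k n) ∈ piece p k n _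
  have h : ((param (k := k) (E p k n) i : E p k n) : R k n) =
      monom k (Finsupp.single i (p ^ (i.val + 1))) [] := by
    rw [coe_param, monom, List.map_nil, List.prod_nil, mul_one, x, ← map_pow, X_pow_eq_monomial]
  rw [h, ← cast_wt, Int.cast_natCast, ← pow_mul_degX]
  refine Submodule.subset_span ⟨_, _, ?_, rfl⟩
  simp [degMonom]

theorem finrank_EPiece (hp : Odd p) (d : ℤ) : Module.Finite k (EPiece p k n d) ∧
    Module.finrank k (EPiece p k n d) =
      {t : (Fin n →₀ ℕ) × BoxIndex p n | (wdeg (wt p) (boxDeg p hp) t : ℤ) = d}.ncard := by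
  refine finrank_of_basis (monomialBasis (boxBasis p k n)) _ d
    (EPiece_eq_span_monomialBasis p k n hp d) ?_
  refine (finite_wdeg_eq (wt p) (boxDeg p hp) (wt_pos p) d.toNat).subset fun t ht => ?_
  change (wdeg (wt p) (boxDeg p hp) t : ℤ) = d at ht
  change wdeg (wt p) (boxDeg p hp) t = d.toNat
  omega

theorem poincareSeries_E (hp : Odd p) :
    poincareSeries (EPiece p k n) = countSeries (wt p) (boxDeg (n := n) p hp) (∅ : Finset (Fin n)) := by
  ext d
  rw [poincareSeries, countSeries, PowerSeries.coeff_mk, PowerSeries.coeff_mk,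
    (finrank_EPiece p k n hp d).2]
  simp

theorem exists_ratFunc (hp : Odd p) : ∃ f : RatFunc ℚ,
    (f : LaurentSeries ℚ) = (poincareSeries (EPiece p k n) : LaurentSeries ℚ) ∧
      RatFunc.eval RatFunc.C (RatFunc.X⁻¹ : RatFunc ℚ) f = (-RatFunc.X) ^ n * f := by
  refine ⟨_, ?_, eval_inv_X_numer_div_denom (wt p) (boxDeg p hp) (wt_pos p)
    (boxDeg p hp (boxTop p n)) (complEquiv p n) (fun j => ?_) ?_⟩
  · rw [poincareSeries_E p k n hp]
    exact coe_numer_div_denom (wt p) (boxDeg p hp) (wt_pos p)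
  · have h1 := boxDeg_complEquiv_add p hp j
    have h2 := boxDeg_complEquiv_add p hp (boxZero p n)
    rw [boxDeg_boxZero] at h2
    change _ = boxDeg p hp (complEquiv p n (boxZero p n))
    omega
  · have h2 := boxDeg_complEquiv_add p hp (boxZero p n)
    rwa [boxDeg_boxZero] at h2

/-- The monomial `α` is the basis element of top degree, up to a sign. -/
theorem exists_smul_boxTop : ∃ u : kˣ, ((u • boxBasis p k n (boxTop p n) : E p k n) : R k n) =
    (List.ofFn fun i : Fin n => x k i ^ (p ^ (i.val + 1) - 1)).prod *
      (List.ofFn fun i : Fin n => ξ k i).prod := by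
  obtain ⟨c, hc, h⟩ := exists_monom_eq (k := k) (boxTop p n).1.1 (List.finRange n)
  refine ⟨Units.mk0 c (hc.2 (List.nodup_finRange n)), ?_⟩
  have h1 : ((boxTop p n).1.1, (List.finRange n).toFinset) = (boxTop p n).1 := by
    refine Prod.ext rfl ?_
    change _ = (∅ : Finset (Fin n))ᶜ
    rw [Finset.compl_empty]
    ext i
    simp
  have h2 : (List.ofFn fun i : Fin n => x k i ^ (p ^ (i.val + 1) - 1)).prod =
      polyIncl k n (monomial (boxTop p n).1.1 1) := by
    have : (List.ofFn fun i : Fin n => x k i ^ (p ^ (i.val + 1) - 1)) =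
        (List.ofFn fun i : Fin n => (X i : MvPolynomial (Fin n) k) ^ (boxTop p n).1.1 i).map
          (polyIncl k n) := by
      rw [List.map_ofFn]
      congr 1
      funext i
      exact (map_pow (polyIncl k n) _ _).symm
    rw [this, ← map_list_prod, List.prod_ofFn, monomial_eq, map_one, one_mul,
      Finsupp.prod_fintype _ _ (by simp)]
  rw [h2, List.ofFn_eq_map]
  change c • ((boxBasis p k n (boxTop p n) : E p k n) : R k n) =
    monom k (boxTop p n).1.1 (List.finRange n)
  rw [h, h1, boxBasis_apply, coe_eBasis]

theorem boxBasis_mem_EPiece (hp : Odd p) (j : BoxIndex p n) :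
    boxBasis p k n j ∈ EPiece p k n (boxDeg p hp j) := by
  rw [EPiece_eq_span, boxBasis_apply]
  refine Submodule.subset_span ⟨_, ?_, rfl⟩
  change tdeg p j.1 = _
  rw [tdeg_eq_boxDeg p hp, Int.cast_natCast]

theorem finrank_quotient_E (hp : Odd p) :
    Module.finrank k (E p k n ⧸ centralIdeal (param (k := k) (n := n) (E p k n))) =
      2 ^ n * p ^ (n * (n - 1) / 2) := by
  rw [Module.finrank_eq_card_basis (quotientBasis (boxBasis p k n)), card_boxIndex p hp]

end Conclusions

end VerAlg

end

theorem mainTheorem4 (p : ℕ) [Fact p.Prime] (hp : Odd p) (k : Type u) [Field k] [CharP k p]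
    (n : ℕ) :
    VerAlg.IsGorenstein (VerAlg.E p k n) ∧
    Nonempty (GradedAlgebra (VerAlg.EPiece p k n)) ∧
    (∃ y : Fin n → Subalgebra.center k (VerAlg.E p k n),
      (∀ i, ((y i : VerAlg.E p k n) : VerAlg.R k n) = VerAlg.x k i ^ p ^ (i.val + 1)) ∧
      (∀ i, (y i : VerAlg.E p k n) ∈ VerAlg.EPiece p k n (2 * ((p : ℤ) ^ (i.val + 1) - 1))) ∧
      VerAlg.IsHomogeneousParameters (VerAlg.EPiece p k n) y ∧
      RingTheory.Sequence.IsRegular (VerAlg.E p k n) (List.ofFn y) ∧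
      Module.finrank k (VerAlg.E p k n ⧸ VerAlg.centralIdeal y) =
        2 ^ n * p ^ (n * (n - 1) / 2) ∧
      ∃ α : VerAlg.E p k n,
        (α : VerAlg.R k n) =
          (List.ofFn fun i : Fin n => VerAlg.x k i ^ (p ^ (i.val + 1) - 1)).prod *
            (List.ofFn fun i : Fin n => VerAlg.ξ k i).prod ∧
        α ∈ VerAlg.EPiece p k n
          (2 * (((p : ℤ) ^ (n + 1) - 1) / ((p : ℤ) - 1)) - 3 * (n : ℤ) - 2) ∧
        VerAlg.IsGradedFrobenius
          (VerAlg.quotientPiece (VerAlg.EPiece p k n) (VerAlg.centralIdeal y))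
          (2 * (((p : ℤ) ^ (n + 1) - 1) / ((p : ℤ) - 1)) - 3 * (n : ℤ) - 2)
          (Ideal.Quotient.mk (VerAlg.centralIdeal y) α)) ∧
    (∀ d : ℤ, Module.Finite k (VerAlg.EPiece p k n d)) ∧
    ∃ f : RatFunc ℚ,
      (f : LaurentSeries ℚ) =
        (VerAlg.poincareSeries (VerAlg.EPiece p k n) : LaurentSeries ℚ) ∧
      RatFunc.eval RatFunc.C (RatFunc.X⁻¹ : RatFunc ℚ) f = (-RatFunc.X) ^ n * f := by
  have : Nonempty (VerAlg.BoxIndex p n) := ⟨VerAlg.boxZero p n⟩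
  obtain ⟨u, hu⟩ := VerAlg.exists_smul_boxTop p k n
  obtain ⟨c, hc⟩ := VerAlg.boxBasis_gram p k n
  refine ⟨VerAlg.isGorenstein_E p k n, VerAlg.gradedAlgebra_EPiece p k n hp,
    ⟨VerAlg.param (VerAlg.E p k n), VerAlg.coe_param p k n, VerAlg.param_mem_EPiece p k n,
      ⟨fun i => ⟨_, ?_, VerAlg.param_mem_EPiece p k n i⟩,
        VerAlg.algebraicIndependent_param (VerAlg.boxBasis p k n),
        VerAlg.finite_adjoin_param (VerAlg.boxBasis p k n)⟩,
      VerAlg.isRegular_param (VerAlg.boxBasis p k n), VerAlg.finrank_quotient_E p k n hp,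
      _, hu, ?_, ?_⟩,
    fun d => (VerAlg.finrank_EPiece p k n hp d).1, VerAlg.exists_ratFunc p k n hp⟩
  · rw [← VerAlg.cast_wt]
    exact_mod_cast VerAlg.wt_pos p i
  · rw [← VerAlg.boxDeg_top p hp]
    exact Submodule.smul_mem _ (u : k) (VerAlg.boxBasis_mem_EPiece p k n hp (VerAlg.boxTop p n))
  · rw [← VerAlg.boxDeg_top p hp]
    refine VerAlg.isGradedFrobenius_quotient (VerAlg.boxBasis p k n) (VerAlg.wt p)
      (VerAlg.boxDeg p hp) (VerAlg.EPiece_eq_span_monomialBasis p k n hp) (VerAlg.boxTop p n)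
      (VerAlg.boxDeg_eq_top_iff p hp) (VerAlg.complEquiv p n) c (fun i j => ?_) _ u rfl
    rw [hc]
    split_ifs
    · exact MvPolynomial.constantCoeff_C _ _
    · exact map_zero _
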